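/- **Setting.** Let $n\ge 1$, $m\ge 0$, let $C,A_1,\dots,A_m\in\mathbb S^n$ (real symmetric $n\times n$ matrices), $b\in\mathbb R^m$, and let $\mathcal A(X)=(\langle A_i,X\rangle)_{i=1}^m$, $\mathcal A^*(y)=\sum_i y_iA_i$, $Z(y)=C-\mathcal A^*(y)$, where $\langle\cdot,\cdot\rangle$ is the trace inner product. Consider $$\text{(P)}\ \min\{\langle C,X\rangle:\mathcal A(X)=b,\ X\succeq0\},\qquad \text{(D)}\ \max\{\langle b,y\rangle: Z(y)\succeq0\},$$ and, for $\rho>0$ and $y\in\mathbb R^m$, with $\mathcal L_\rho(X,y)=\langle C,X\rangle+\langle y,b-\mathcal A(X)\rangle+\frac\rho2\|\mathcal A(X)-b\|_2^2$, $$\text{(AL-P)}\ \min_{X\succeq0}\mathcal L_\rho(X,y),\qquad \text{(AL-D)}\ \max\{\langle b,z\rangle-\tfrac1{2\rho}\|z-y\|_2^2: Z(z)\succeq0\}.$$ (P) is *primal simple* if (i) (P) and (D) have optimal solutions and every optimal pair $(X,y)$ satisfies $\langle C,X\rangle=\langle b,y\rangle$; (ii) some optimal pair with equal objective values is *strictly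 complementary*: $\operatorname{rank}X+\operatorname{rank}Z(y)=n$; (iii) the solution of (P) is unique. (AL-P) is *primal simple* if (i) (AL-P) and (AL-D) have optimal solutions and every optimal pair $(X,z)$ satisfies the KKT conditions $\mathcal A(X)=\frac1\rho(y-z)+b$, $Z(z)X=0$, $X\succeq0$, $Z(z)\succeq0$; (ii) some optimal pair satisfying these conditions has $\operatorname{rank}X+\operatorname{rank}Z(z)=n$; (iii) the solution of (AL-P) is unique. The *dual Slater condition* is: $Z(y_0)\succ0$ for some $y_0\in\mathbb R^m$. For a linear map $\mathcal B:\mathbb S^d\to\mathbb R^m$ let $\sigma_{\max}(\mathcal B)=\sup_{S\ne0}\|\mathcal B(S)\|_2/\|S\|_F$ and $\sigma_{\min}(\mathcal B)=\inf_{S\neq0}\|\mathcal B(S)\|_2/\|S\|_F$ (with $\sigma_{\min}=+\infty$ if $d=0$), and for $V\in\mathbb R^{n\times r}$ let $\mathcal A_V(S)=\mathcal A(VSV^\top)$, $S\in\mathbb S^r$. Let $\lambda_1\ge\dots\ge\lambda_n$ denote ordered eigenvalues, with the convention $\lambda_0=+\infty$. **Theorem.** Suppose (P) is primal simple and the dual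 Slater condition holds. Let $(X_\star,y_\star)$ be an optimal strictly complementary pair of (P) and (D), let $r_\star=\operatorname{rank}X_\star$, and let $V_\star\in\mathbb R^{n\times r_\star}$ have orthonormal columns spanning the null space of $Z(y_\star)$. Then for every $\rho_0>0$ there is $c>0$ such that for every $\rho\ge\rho_0$ the following hold. 1. For every $y$ with $\|y-y_\star\|_2\le c$, (AL-P) is primal simple, and every pair $(X_{y,\rho},z_{y,\rho})$ of optimal solutions of (AL-P) and (AL-D) satisfies $$\operatorname{rank}(X_{y,\rho})=\operatorname{rank}(X_\star),\qquad \operatorname{rank}(Z(z_{y,\rho}))=\operatorname{rank}(Z(y_\star)).$$ 2. For every $B>0$ there is a constant $\gamma>0$, independent of $y$, with $$\gamma\ \ge\ \min\left\{\frac{\lambda_{n-r_\star}(Z(y_\star))}{B\left(4+10\,\frac{\sigma_{\max}(\mathcal A)^2}{\sigma_{\min}(\mathcal A_{V_\star})^2}\right)},\ \frac{\rho\,\sigma_{\min}(\mathcal A_{V_\star})^2}{10}\right\},$$ such that for every $y$ with $\|y-y_\star\|_2\le c$, every pair $(X_{y,\rho},z_{y,\rho})$ of optimal solutions of (AL-P)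 and (AL-D), and every $X\succeq0$ with nuclear norm $\|X\|_*\le B$, $$\mathcal L_\rho(X,y)-\mathcal L_\rho(X_{y,\rho},y)=\langle Z(z_{y,\rho}),X\rangle+\frac\rho2\|\mathcal A(X)-\mathcal A(X_{y,\rho})\|_2^2\ \ge\ \gamma\,\|X-X_{y,\rho}\|_F^2 .$$ -/

import Mathlib

open scoped MatrixOrder

noncomputable section

/-! Norms and spectral quantities of real matrices. -/

/-- The trace inner product on real matrices. -/
def frobInner {n : ℕ} (X Y : Matrix (Fin n) (Fin n) ℝ) : ℝ :=
  (X.transpose * Y).trace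

section
open scoped Matrix.Norms.Frobenius

/-- The Frobenius norm. -/
def frobNorm {n : ℕ} (X : Matrix (Fin n) (Fin n) ℝ) : ℝ := ‖X‖

end

/-- The nuclear norm, i.e. the trace of the matrix absolute value `(Xᵀ X)^{1/2}`. -/
def nucNorm {n : ℕ} (X : Matrix (Fin n) (Fin n) ℝ) : ℝ :=
  (CFC.abs X).trace

/-- The `k`-th largest eigenvalue `λ_k(Z)`, `1 ≤ k ≤ n`, of a symmetric matrix `Z`,
counted with multiplicity, with the conventions `λ_0 = +∞` and `λ_k = -∞` for `k > n`. -/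
def kthEigenvalue {n : ℕ} {Z : Matrix (Fin n) (Fin n) ℝ} (hZ : Z.IsHermitian) (k : ℕ) :
    EReal :=
  if k = 0 then ⊤
  else if h : k - 1 < Fintype.card (Fin n) then ((hZ.eigenvalues₀ ⟨k - 1, h⟩ : ℝ) : EReal)
  else ⊥

/-- `σ_max(𝓑)`: the operator norm of `𝓑` on symmetric matrices with the Frobenius norm. -/
def sigmaMax {d m : ℕ} (B : Matrix (Fin d) (Fin d) ℝ →ₗ[ℝ] EuclideanSpace ℝ (Fin m)) : ℝ :=
  ⨆ S : {S : Matrix (Fin d) (Fin d) ℝ // S.IsSymm ∧ S ≠ 0}, ‖B S.1‖ / frobNorm S.1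

/-- `σ_min(𝓑)`: the infimum of `‖𝓑(S)‖ / ‖S‖_F` over nonzero symmetric `S`. It is extended
real valued only because there is no such `S` when `d = 0`; the value is then `+∞`. -/
def sigmaMin {d m : ℕ} (B : Matrix (Fin d) (Fin d) ℝ →ₗ[ℝ] EuclideanSpace ℝ (Fin m)) : EReal :=
  ⨅ S : {S : Matrix (Fin d) (Fin d) ℝ // S.IsSymm ∧ S ≠ 0},
    ((‖B S.1‖ / frobNorm S.1 : ℝ) : EReal)

/-- The restricted map `𝓑_V(S) = 𝓑(V S Vᵀ)`. -/
def restrictMap {d r m : ℕ} (B : Matrix (Fin d) (Fin d) ℝ →ₗ[ℝ] EuclideanSpace ℝ (Fin m))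
    (V : Matrix (Fin d) (Fin r) ℝ) :
    Matrix (Fin r) (Fin r) ℝ →ₗ[ℝ] EuclideanSpace ℝ (Fin m) where
  toFun S := B (V * S * V.transpose)
  map_add' S T := by rw [Matrix.mul_add, Matrix.add_mul, map_add]
  map_smul' a S := by simp

/-- The data `(𝓐, b, C)` of a semidefinite program, `𝓐` being given by the symmetric matrices
`A 1, …, A m`. -/
structure SDP (n m : ℕ) where
  A : Fin m → Matrix (Fin n) (Fin n) ℝ
  C : Matrix (Fin n) (Fin n) ℝ
  b : EuclideanSpace ℝ (Fin m)
  A_symm : ∀ i, (A i).IsSymm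
  C_symm : C.IsSymm

namespace SDP

variable {n m : ℕ} (P : SDP n m)

/-- The linear map `𝓐`, with `[𝓐(X)]_i = ⟨A_i, X⟩`. -/
def Amap : Matrix (Fin n) (Fin n) ℝ →ₗ[ℝ] EuclideanSpace ℝ (Fin m) where
  toFun X := WithLp.toLp 2 (fun i => frobInner (P.A i) X)
  map_add' X Y := by
    ext i
    simp [frobInner, Matrix.mul_add]
  map_smul' a X := by
    ext i
    simp [frobInner]

/-- The adjoint map `𝓐^*(y) = ∑ i, y_i A_i`. -/
def Aadj (y : EuclideanSpace ℝ (Fin m)) : Matrix (Fin n) (Fin n) ℝ :=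
  ∑ i, y i • P.A i

/-- `𝓐^*` is the adjoint of `𝓐`. -/
theorem inner_Amap (X : Matrix (Fin n) (Fin n) ℝ) (y : EuclideanSpace ℝ (Fin m)) :
    inner ℝ y (P.Amap X) = frobInner (P.Aadj y) X := by
  simp [Amap, Aadj, frobInner, PiLp.inner_apply, Matrix.transpose_sum, Finset.sum_mul,
    Matrix.trace_sum, mul_comm]

/-- The dual slack `Z(y) = C - 𝓐^*(y)`. -/
def Z (y : EuclideanSpace ℝ (Fin m)) : Matrix (Fin n) (Fin n) ℝ := P.C - P.Aadj y

theorem Z_isHermitian (y : EuclideanSpace ℝ (Fin m)) : (P.Z y).IsHermitian := by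
  have h : ∀ i, (P.A i).transpose = P.A i := P.A_symm
  have hC : P.C.transpose = P.C := P.C_symm
  simp [Matrix.IsHermitian, Z, Aadj, Matrix.conjTranspose_eq_transpose_of_trivial,
    Matrix.transpose_sum, h, hC]

/-! The primal problem `min ⟨C, X⟩ s.t. 𝓐 X = b, X ⪰ 0` and its dual
`max ⟨b, y⟩ s.t. C - 𝓐^* y ⪰ 0`. -/

/-- Feasibility for the primal problem. -/
def PrimalFeasible (X : Matrix (Fin n) (Fin n) ℝ) : Prop :=
  P.Amap X = P.b ∧ X.PosSemidef

/-- Optimality for the primal problem. -/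
def PrimalOptimal (X : Matrix (Fin n) (Fin n) ℝ) : Prop :=
  P.PrimalFeasible X ∧ ∀ X', P.PrimalFeasible X' → frobInner P.C X ≤ frobInner P.C X'

/-- Feasibility for the dual problem. -/
def DualFeasible (y : EuclideanSpace ℝ (Fin m)) : Prop := (P.Z y).PosSemidef

/-- Optimality for the dual problem. -/
def DualOptimal (y : EuclideanSpace ℝ (Fin m)) : Prop :=
  P.DualFeasible y ∧ ∀ y', P.DualFeasible y' → inner ℝ P.b y' ≤ inner ℝ P.b y

/-- Dual Slater condition. -/
def DualSlater : Prop := ∃ y, (P.Z y).PosDef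

/-- Strong duality: optimal pairs exist, and every optimal pair has equal objective values. -/
def StrongDuality : Prop :=
  (∃ X y, P.PrimalOptimal X ∧ P.DualOptimal y) ∧
  ∀ X y, P.PrimalOptimal X → P.DualOptimal y → frobInner P.C X = inner ℝ P.b y

/-- An optimal primal-dual pair that satisfies strict complementarity. -/
def StrictComplementaryPair (X : Matrix (Fin n) (Fin n) ℝ) (y : EuclideanSpace ℝ (Fin m)) :
    Prop :=
  P.PrimalOptimal X ∧ P.DualOptimal y ∧ frobInner P.C X = inner ℝ P.b y ∧
    X.rank + (P.Z y).rank = n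

/-- Primal simplicity: strong duality, strict complementarity, unique primal solution. -/
def PrimalSimple : Prop :=
  P.StrongDuality ∧ (∃ X y, P.StrictComplementaryPair X y) ∧ ∃! X, P.PrimalOptimal X

/-! The augmented Lagrangian subproblem `min L_ρ(X, y) s.t. X ⪰ 0` and its dual
`max ⟨b, z⟩ - ‖z - y‖² / (2ρ) s.t. C - 𝓐^* z ⪰ 0`. -/

/-- The augmented Lagrangian. -/
def augLagrangian (ρ : ℝ) (X : Matrix (Fin n) (Fin n) ℝ) (y : EuclideanSpace ℝ (Fin m)) : ℝ :=
  frobInner P.C X + inner ℝ y (P.b - P.Amap X) + ρ / 2 * ‖P.Amap X - P.b‖ ^ 2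

/-- `X` solves the subproblem with parameters `ρ` and `y`. -/
def ALPrimalOptimal (ρ : ℝ) (y : EuclideanSpace ℝ (Fin m)) (X : Matrix (Fin n) (Fin n) ℝ) :
    Prop :=
  X.PosSemidef ∧
    ∀ X' : Matrix (Fin n) (Fin n) ℝ, X'.PosSemidef →
      P.augLagrangian ρ X y ≤ P.augLagrangian ρ X' y

/-- Objective of the dual subproblem. -/
def ALDualObjective (ρ : ℝ) (y z : EuclideanSpace ℝ (Fin m)) : ℝ :=
  inner ℝ P.b z - 1 / (2 * ρ) * ‖z - y‖ ^ 2

/-- `z` solves the dual subproblem with parameters `ρ` and `y`. -/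
def ALDualOptimal (ρ : ℝ) (y z : EuclideanSpace ℝ (Fin m)) : Prop :=
  P.DualFeasible z ∧ ∀ z', P.DualFeasible z' → P.ALDualObjective ρ y z' ≤ P.ALDualObjective ρ y z

/-- The KKT conditions of the subproblem. -/
def ALKKT (ρ : ℝ) (y : EuclideanSpace ℝ (Fin m)) (X : Matrix (Fin n) (Fin n) ℝ)
    (z : EuclideanSpace ℝ (Fin m)) : Prop :=
  P.Amap X = (1 / ρ) • (y - z) + P.b ∧ P.Z z * X = 0 ∧ X.PosSemidef ∧ (P.Z z).PosSemidef

/-- Strong duality for the subproblem: optimal pairs exist, and all of them satisfy KKT. -/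
def ALStrongDuality (ρ : ℝ) (y : EuclideanSpace ℝ (Fin m)) : Prop :=
  (∃ X z, P.ALPrimalOptimal ρ y X ∧ P.ALDualOptimal ρ y z) ∧
  ∀ X z, P.ALPrimalOptimal ρ y X → P.ALDualOptimal ρ y z → P.ALKKT ρ y X z

/-- Strict complementarity for the subproblem. -/
def ALStrictComplementarity (ρ : ℝ) (y : EuclideanSpace ℝ (Fin m)) : Prop :=
  ∃ X z, P.ALPrimalOptimal ρ y X ∧ P.ALDualOptimal ρ y z ∧ P.ALKKT ρ y X z ∧
    X.rank + (P.Z z).rank = n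

/-- Primal simplicity of the subproblem. -/
def ALPrimalSimple (ρ : ℝ) (y : EuclideanSpace ℝ (Fin m)) : Prop :=
  P.ALStrongDuality ρ y ∧ P.ALStrictComplementarity ρ y ∧ ∃! X, P.ALPrimalOptimal ρ y X

/-- The explicit quadratic growth constant
`min { λ_{n-r}(Z(y)) / (B (4 + 10 (σ_max(𝓐) / σ_min(𝓐_V))²)), ρ σ_min(𝓐_V)² / 10 }`. -/
def growthBound {r : ℕ} (y : EuclideanSpace ℝ (Fin m)) (V : Matrix (Fin n) (Fin r) ℝ)
    (ρ B : ℝ) : EReal :=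
  min
    (kthEigenvalue (P.Z_isHermitian y) (n - r) /
      ((B : EReal) *
        (4 + 10 * ((sigmaMax P.Amap : EReal) / sigmaMin (restrictMap P.Amap V)) ^ 2)))
    ((ρ : EReal) * sigmaMin (restrictMap P.Amap V) ^ 2 / 10)

end SDP

end

/-!
Everything rests on one quadratic growth estimate. Let `Z ⪰ 0`, let `Q` be the orthogonal projection
onto the range of `Z`, and suppose that `Q ⪯ β Z`, that `‖D‖ ≤ α ‖𝓐 D‖` for symmetric `D` supported
on `ker Z`, and that `‖𝓐 E‖ ≤ M ‖E‖`. For `X₀` supported on `ker Z` and `X ⪰ 0` of trace at most `B`,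
split `X - X₀` into the compression to `ker Z` and the rest. The rest has squared norm at most
`2 B tr(Q X) ≤ 2 B β ⟨Z, X⟩`, because `X ⪰ 0`; the compression is controlled by `𝓐` through `α`. The
result, `quadratic_growth`, bounds `‖X - X₀‖²` by `⟨Z, X⟩ + ρ/2 ‖𝓐 X - 𝓐 X₀‖²`, with a constant better
than the claimed one by a fixed factor.

At the nominal pair these hypotheses hold with `β = 1/λ_{n-r}` and `α = 1/σ_min(𝓐_V)`
(`SDP.StrictComplementaryPair.exists_growth_data`): by strict complementarity the compression of
the primal solution to `ker Z(ys)` is positive definite, so a kernel element of `𝓐_V` would be a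
direction of further primal solutions. Setting `α = 0` if `r = 0`, and `β = 0` if `r = n`, treats the
degenerate cases together with the generic one.

A minimizer of the augmented Lagrangian exists because dual Slater makes it coercive, and first-order
optimality over the cone gives the KKT conditions with `z = y - ρ (𝓐 X - b)`; strict concavity makes
`z` the only dual solution. The map `y ↦ z` is a proximal map that fixes `ys`, whence
`‖z - ys‖ ≤ ‖y - ys‖` for every `ρ`, and growth at the nominal pair then shows that `X` is close to
the primal solution, uniformly in `ρ ≥ ρ₀` (`SDP.StrictComplementaryPair.exists_radius`).

Closeness has two consequences. The ranks of `X` and `Z(z)` cannot drop (`rank_le_of_norm_sub_mul_lt`),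
and as they add up to at most `n` they are the nominal ones. Also `α` and `β` deteriorate only by
`4/3` and `5/4` (`norm_le_of_perturb`, `frobInner_proj_le_of_perturb`), which the slack in the
constants absorbs. So growth holds at every nearby pair, and uniqueness of the minimizer is a special
case of it.
-/

section

open scoped Matrix.Norms.Frobenius

/-! ### The Frobenius inner product and orthogonal projections -/

section Frobenius

variable {n : ℕ} {X Y Z Q W : Matrix (Fin n) (Fin n) ℝ}

theorem frobInner_add_left (X Y W : Matrix (Fin n) (Fin n) ℝ) :
    frobInner (X + Y) W = frobInner X W + frobInner Y W := by
  simp [frobInner, Matrix.add_mul]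

theorem frobInner_add_right (X Y W : Matrix (Fin n) (Fin n) ℝ) :
    frobInner W (X + Y) = frobInner W X + frobInner W Y := by
  simp [frobInner, Matrix.mul_add]

theorem frobInner_sub_left (X Y W : Matrix (Fin n) (Fin n) ℝ) :
    frobInner (X - Y) W = frobInner X W - frobInner Y W := by
  simp [frobInner, Matrix.sub_mul]

theorem frobInner_sub_right (X Y W : Matrix (Fin n) (Fin n) ℝ) :
    frobInner W (X - Y) = frobInner W X - frobInner W Y := by
  simp [frobInner, Matrix.mul_sub]

theorem frobInner_smul_left (a : ℝ) (X Y : Matrix (Fin n) (Fin n) ℝ) :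
    frobInner (a • X) Y = a * frobInner X Y := by
  simp [frobInner]

theorem frobInner_smul_right (a : ℝ) (X Y : Matrix (Fin n) (Fin n) ℝ) :
    frobInner X (a • Y) = a * frobInner X Y := by
  simp [frobInner]

@[simp] theorem frobInner_zero_left (X : Matrix (Fin n) (Fin n) ℝ) : frobInner 0 X = 0 := by
  simp [frobInner]

@[simp] theorem frobInner_zero_right (X : Matrix (Fin n) (Fin n) ℝ) : frobInner X 0 = 0 := by
  simp [frobInner]

theorem frobInner_comm (X Y : Matrix (Fin n) (Fin n) ℝ) : frobInner X Y = frobInner Y X := by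
  rw [frobInner, frobInner, ← Matrix.trace_transpose]
  simp

theorem frobInner_mul_left (X Y W : Matrix (Fin n) (Fin n) ℝ) :
    frobInner (X * Y) W = frobInner Y (X.transpose * W) := by
  simp [frobInner, Matrix.mul_assoc]

theorem frobInner_mul_right (X Y W : Matrix (Fin n) (Fin n) ℝ) :
    frobInner (X * Y) W = frobInner X (W * Y.transpose) := by
  rw [frobInner, frobInner, Matrix.transpose_mul, Matrix.mul_assoc, Matrix.trace_mul_comm,
    Matrix.mul_assoc]

theorem frobNorm_eq_norm (X : Matrix (Fin n) (Fin n) ℝ) : frobNorm X = ‖X‖ := rfl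

theorem norm_sq_eq_trace {r s : ℕ} (X : Matrix (Fin r) (Fin s) ℝ) :
    ‖X‖ ^ 2 = (X.transpose * X).trace := by
  rw [Matrix.frobenius_norm_def, ← Real.sqrt_eq_rpow, Real.sq_sqrt (by positivity),
    Finset.sum_comm]
  simp [Matrix.trace, Matrix.mul_apply, sq]

theorem norm_sq_eq_frobInner (X : Matrix (Fin n) (Fin n) ℝ) : ‖X‖ ^ 2 = frobInner X X :=
  norm_sq_eq_trace X

theorem norm_sub_sq_frobInner (X Y : Matrix (Fin n) (Fin n) ℝ) :
    ‖X - Y‖ ^ 2 = ‖X‖ ^ 2 - 2 * frobInner X Y + ‖Y‖ ^ 2 := by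
  simp only [norm_sq_eq_frobInner, frobInner_sub_left, frobInner_sub_right, frobInner_comm Y X]
  ring

theorem norm_add_sq_of_frobInner_eq_zero (h : frobInner X Y = 0) :
    ‖X + Y‖ ^ 2 = ‖X‖ ^ 2 + ‖Y‖ ^ 2 := by
  simp only [norm_sq_eq_frobInner, frobInner_add_left, frobInner_add_right, frobInner_comm Y X, h]
  ring

theorem frobInner_le_norm_mul_norm (X Y : Matrix (Fin n) (Fin n) ℝ) :
    frobInner X Y ≤ ‖X‖ * ‖Y‖ := by
  rcases eq_or_ne X 0 with rfl | hX
  · simp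
  rcases eq_or_ne Y 0 with rfl | hY
  · simp
  have h := sq_nonneg ‖‖Y‖ • X - ‖X‖ • Y‖
  rw [norm_sub_sq_frobInner, norm_smul, norm_smul, frobInner_smul_left, frobInner_smul_right,
    norm_norm, norm_norm] at h
  have hXY : 0 < ‖X‖ * ‖Y‖ := mul_pos (norm_pos_iff.2 hX) (norm_pos_iff.2 hY)
  have : 0 ≤ 2 * (‖X‖ * ‖Y‖) * (‖X‖ * ‖Y‖ - frobInner X Y) := by linarith
  nlinarith [nonneg_of_mul_nonneg_right this (by positivity)]

/-- The symmetric idempotent matrices, that is, the orthogonal projections. -/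
structure IsOrthProj (Q : Matrix (Fin n) (Fin n) ℝ) : Prop where
  symm : Q.transpose = Q
  idem : Q * Q = Q

namespace IsOrthProj

theorem idem_assoc (hQ : IsOrthProj Q) (W : Matrix (Fin n) (Fin n) ℝ) : Q * (Q * W) = Q * W := by
  rw [← Matrix.mul_assoc, hQ.idem]

theorem compl (hQ : IsOrthProj Q) : IsOrthProj (1 - Q) where
  symm := by simp [hQ.symm]
  idem := by simp [Matrix.sub_mul, Matrix.mul_sub, hQ.idem]

theorem norm_sq_add (hQ : IsOrthProj Q) (W : Matrix (Fin n) (Fin n) ℝ) :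
    ‖W‖ ^ 2 = ‖Q * W‖ ^ 2 + ‖(1 - Q) * W‖ ^ 2 := by
  rw [← norm_add_sq_of_frobInner_eq_zero, ← Matrix.add_mul, add_sub_cancel, Matrix.one_mul]
  rw [frobInner_mul_left, hQ.symm, Matrix.sub_mul, Matrix.mul_sub, hQ.idem_assoc]
  simp

theorem norm_mul_le (hQ : IsOrthProj Q) (W : Matrix (Fin n) (Fin n) ℝ) : ‖Q * W‖ ≤ ‖W‖ := by
  refine le_of_sq_le_sq ?_ (norm_nonneg _)
  rw [hQ.norm_sq_add W]
  nlinarith [sq_nonneg ‖(1 - Q) * W‖]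

end IsOrthProj

end Frobenius

/-! ### Positive semidefinite matrices -/

section PosSemidef

variable {n : ℕ} {X Y Z Q W : Matrix (Fin n) (Fin n) ℝ}

theorem Matrix.PosSemidef.transpose_eq (hX : X.PosSemidef) : X.transpose = X := by
  have := hX.1
  rwa [Matrix.IsHermitian, Matrix.conjTranspose_eq_transpose_of_trivial] at this

theorem Matrix.PosSemidef.exists_eq_mul_transpose (hX : X.PosSemidef) :
    ∃ R : Matrix (Fin n) (Fin n) ℝ, X = R * R.transpose := by
  obtain ⟨R, hR⟩ := CStarAlgebra.nonneg_iff_eq_star_mul_self.1 hX.nonneg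
  refine ⟨R.transpose, ?_⟩
  rw [hR, Matrix.star_eq_conjTranspose, Matrix.conjTranspose_eq_transpose_of_trivial,
    Matrix.transpose_transpose]

theorem frobInner_mul_transpose (Z R : Matrix (Fin n) (Fin n) ℝ) :
    frobInner Z (R * R.transpose) = frobInner R (Z * R) := by
  rw [frobInner_comm R, frobInner_mul_right]

theorem Matrix.PosSemidef.frobInner_mul_nonneg (hZ : Z.PosSemidef)
    (R : Matrix (Fin n) (Fin n) ℝ) : 0 ≤ frobInner R (Z * R) := by
  have := (hZ.conjTranspose_mul_mul_same R).trace_nonneg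
  rwa [Matrix.conjTranspose_eq_transpose_of_trivial, Matrix.mul_assoc] at this

theorem Matrix.PosSemidef.frobInner_nonneg (hZ : Z.PosSemidef) (hX : X.PosSemidef) :
    0 ≤ frobInner Z X := by
  obtain ⟨R, rfl⟩ := hX.exists_eq_mul_transpose
  rw [frobInner_mul_transpose]
  exact hZ.frobInner_mul_nonneg R

theorem Matrix.PosSemidef.mul_eq_zero_of_frobInner_eq_zero (hZ : Z.PosSemidef)
    (hX : X.PosSemidef) (h : frobInner Z X = 0) : Z * X = 0 := by
  obtain ⟨R, rfl⟩ := hX.exists_eq_mul_transpose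
  obtain ⟨S, rfl⟩ := hZ.exists_eq_mul_transpose
  rw [frobInner_mul_transpose, Matrix.mul_assoc, frobInner_comm, frobInner_mul_left,
    ← norm_sq_eq_frobInner, sq_eq_zero_iff, norm_eq_zero] at h
  rw [Matrix.mul_assoc, ← Matrix.mul_assoc S.transpose, h]
  simp

theorem Matrix.PosSemidef.of_frobInner_nonneg (hZ : Z.transpose = Z)
    (h : ∀ X : Matrix (Fin n) (Fin n) ℝ, X.PosSemidef → 0 ≤ frobInner Z X) : Z.PosSemidef := by
  refine Matrix.PosSemidef.of_dotProduct_mulVec_nonneg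
    (by rwa [Matrix.IsHermitian, Matrix.conjTranspose_eq_transpose_of_trivial]) fun x => ?_
  have := h _ (Matrix.posSemidef_vecMulVec_self_star x)
  rwa [frobInner, hZ, Matrix.mul_vecMulVec, Matrix.trace_vecMulVec, dotProduct_comm] at this

/-- A positive semidefinite matrix has nuclear norm equal to its trace. -/
theorem Matrix.PosSemidef.nucNorm_eq_trace (hX : X.PosSemidef) : nucNorm X = X.trace := by
  rw [nucNorm, CFC.abs_of_nonneg X hX.nonneg]

theorem frobInner_one_left (X : Matrix (Fin n) (Fin n) ℝ) : frobInner 1 X = X.trace := by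
  simp [frobInner]

/-- `‖Q X‖² ≤ tr(Q X) tr X`: write `X = R Rᵀ`, so that `tr(Q X) = ‖Q R‖²` and `tr X = ‖R‖²`. -/
theorem IsOrthProj.norm_mul_sq_le (hQ : IsOrthProj Q) (hX : X.PosSemidef) :
    ‖Q * X‖ ^ 2 ≤ frobInner Q X * X.trace := by
  obtain ⟨R, rfl⟩ := hX.exists_eq_mul_transpose
  have h1 : frobInner Q (R * R.transpose) = ‖Q * R‖ ^ 2 := by
    rw [frobInner_mul_transpose, norm_sq_eq_frobInner, frobInner_mul_left, hQ.symm, hQ.idem_assoc]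
  have h2 : (R * R.transpose).trace = ‖R‖ ^ 2 := by
    rw [norm_sq_eq_trace, Matrix.trace_mul_comm]
  rw [h1, h2, ← mul_pow, ← Matrix.mul_assoc]
  have := Matrix.frobenius_norm_mul (Q * R) R.transpose
  rw [Matrix.frobenius_norm_transpose] at this
  gcongr

theorem Matrix.PosSemidef.norm_le_trace (hX : X.PosSemidef) : ‖X‖ ≤ X.trace := by
  have h1 : IsOrthProj (1 : Matrix (Fin n) (Fin n) ℝ) := ⟨by simp, by simp⟩
  have h2 := h1.norm_mul_sq_le hX
  rw [Matrix.one_mul, frobInner_one_left, ← sq] at h2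
  exact le_of_sq_le_sq h2 hX.trace_nonneg

end PosSemidef

/-! ### Spectral projections and the stability of the rank -/

section Spectral

variable {n : ℕ} {X Z Q N A G : Matrix (Fin n) (Fin n) ℝ}

/-- If `G` is a partial inverse of `A`, then every matrix close to `A` has rank at least that
of `A`. -/
theorem rank_le_of_norm_sub_mul_lt (hA : A * (G * A) = A) (h : ‖A - N‖ * ‖G‖ < 1) :
    A.rank ≤ N.rank := by
  have hF : ‖G * (A - N)‖ < 1 := by
    refine lt_of_le_of_lt (Matrix.frobenius_norm_mul _ _) ?_
    rwa [mul_comm]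
  have hU := (Matrix.isUnit_iff_isUnit_det _).1 (isUnit_one_sub_of_norm_lt_one hF)
  have key : (1 - G * (A - N)) * (G * A) = G * N * (G * A) := by
    rw [Matrix.sub_mul, Matrix.mul_sub, Matrix.sub_mul, Matrix.mul_assoc G A, hA]
    simp
  have h1 := Matrix.rank_mul_eq_right_of_isUnit_det _ (G * A) hU
  have h2 : A.rank ≤ (G * A).rank := by
    conv_lhs => rw [← hA]
    exact Matrix.rank_mul_le_right _ _
  rw [key] at h1
  rw [← h1] at h2
  exact h2.trans ((Matrix.rank_mul_le_left _ _).trans (Matrix.rank_mul_le_right _ _))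

/-- The projection `Q` onto the range of a symmetric matrix `A`, a pseudoinverse `G`, and the
Loewner bound `Q ≤ β A`, valid as soon as `β⁻¹` bounds the nonzero eigenvalues from below. -/
theorem Matrix.IsHermitian.exists_range_projection (hA : A.IsHermitian) :
    ∃ Q G : Matrix (Fin n) (Fin n) ℝ, IsOrthProj Q ∧ A * Q = A ∧ G * A = Q ∧
      ∀ β : ℝ, (∀ i, hA.eigenvalues i ≠ 0 → 1 ≤ β * hA.eigenvalues i) →
        (β • A - Q).PosSemidef := by
  set U : Matrix (Fin n) (Fin n) ℝ := hA.eigenvectorUnitary.1 with hU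
  set e := hA.eigenvalues with he
  have hUU : U.transpose * U = 1 := by
    have := Unitary.coe_star_mul_self hA.eigenvectorUnitary
    rwa [Matrix.star_eq_conjTranspose, Matrix.conjTranspose_eq_transpose_of_trivial] at this
  have hA' : A = U * Matrix.diagonal e * U.transpose := by
    have := hA.spectral_theorem
    rwa [Unitary.conjStarAlgAut_apply, Matrix.star_eq_conjTranspose,
      Matrix.conjTranspose_eq_transpose_of_trivial] at this
  have hmul : ∀ d d' : Fin n → ℝ, (U * Matrix.diagonal d * U.transpose) *
      (U * Matrix.diagonal d' * U.transpose) =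
        U * Matrix.diagonal (fun i => d i * d' i) * U.transpose := by
    intro d d'
    rw [← Matrix.diagonal_mul_diagonal]
    simp only [Matrix.mul_assoc]
    rw [← Matrix.mul_assoc U.transpose U, hUU, Matrix.one_mul]
  refine ⟨U * Matrix.diagonal (fun i => if e i = 0 then 0 else 1) * U.transpose,
    U * Matrix.diagonal (fun i => (e i)⁻¹) * U.transpose, ⟨?_, ?_⟩, ?_, ?_, ?_⟩
  · simp [Matrix.mul_assoc]
  · rw [hmul]
    congr 3
    ext i
    split_ifs <;> simp
  · conv_lhs => rw [hA']
    conv_rhs => rw [hA']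
    rw [hmul]
    congr 3
    ext i
    split_ifs with h <;> simp [h]
  · conv_lhs => rw [hA']
    rw [hmul]
    congr 3
    ext i
    split_ifs with h <;> simp [h]
  · intro β hβ
    have : β • A - U * Matrix.diagonal (fun i => if e i = 0 then 0 else 1) * U.transpose =
        U * Matrix.diagonal (fun i => β * e i - if e i = 0 then 0 else 1) * U.conjTranspose := by
      conv_lhs => rw [hA']
      rw [Matrix.conjTranspose_eq_transpose_of_trivial, ← Matrix.smul_mul, ← Matrix.mul_smul,
        ← Matrix.diagonal_smul, ← Matrix.sub_mul, ← Matrix.mul_sub, Matrix.diagonal_sub]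
      rfl
    rw [this]
    refine Matrix.PosSemidef.mul_mul_conjTranspose_same (Matrix.PosSemidef.diagonal ?_) U
    intro i
    dsimp only [Pi.zero_apply]
    split_ifs with h
    · simp [h]
    · linarith [hβ i h]

/-- For a positive semidefinite matrix of rank `k ≥ 1`, the eigenvalue `λ_k` is its least nonzero
eigenvalue. -/
theorem Matrix.PosSemidef.kthEigenvalue_rank (hZ : Z.PosSemidef) (hk : Z.rank ≠ 0) :
    ∃ l : ℝ, 0 < l ∧ kthEigenvalue hZ.1 Z.rank = (l : EReal) ∧
      ∀ i, hZ.1.eigenvalues i ≠ 0 → l ≤ hZ.1.eigenvalues i := by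
  set e := hZ.1.eigenvalues₀ with he
  have hanti : Antitone e := hZ.1.eigenvalues₀_antitone
  let σ := Fintype.equivOfCardEq (Fintype.card_fin (Fintype.card (Fin n)))
  have heig : ∀ i, hZ.1.eigenvalues i = e (σ.symm i) := fun i => rfl
  have hnn : ∀ j, 0 ≤ e j := fun j => by
    have := hZ.eigenvalues_nonneg (σ j)
    rwa [heig, Equiv.symm_apply_apply] at this
  have hcard : Z.rank = (Finset.univ.filter fun j => e j ≠ 0).card := by
    rw [hZ.1.rank_eq_card_non_zero_eigs, Fintype.card_subtype]
    refine Finset.card_bij' (fun i _ => σ.symm i) (fun j _ => σ j) ?_ ?_ ?_ ?_ <;> simp [heig]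
  have hle : Z.rank ≤ Fintype.card (Fin n) := by
    rw [hcard]
    exact (Finset.card_le_univ _).trans (by simp)
  -- A nonzero `e j` forces `e 0, …, e j` to be nonzero, whence `j + 1 ≤ rank`, and conversely.
  have hlt : ∀ j : Fin (Fintype.card (Fin n)), e j ≠ 0 → j.val + 1 ≤ Z.rank := by
    intro j hj
    rw [hcard, ← Fin.card_Iic j]
    refine Finset.card_le_card fun i hi => ?_
    simp only [Finset.mem_Iic] at hi
    simp only [Finset.mem_filter, Finset.mem_univ, true_and]
    exact ((lt_of_le_of_ne (hnn j) (Ne.symm hj)).trans_le (hanti hi)).ne'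
  have hidx : Z.rank - 1 < Fintype.card (Fin n) := by omega
  have hpos : e ⟨Z.rank - 1, hidx⟩ ≠ 0 := by
    intro h0
    have : (Finset.univ.filter fun j => e j ≠ 0) ⊆ Finset.Iio ⟨Z.rank - 1, hidx⟩ := by
      intro j hj
      simp only [Finset.mem_filter, Finset.mem_univ, true_and] at hj
      simp only [Finset.mem_Iio]
      by_contra hcon
      exact hj (le_antisymm ((hanti (not_lt.1 hcon)).trans h0.le) (hnn j))
    have := Finset.card_le_card this
    rw [← hcard, Fin.card_Iio] at this
    simp only at this
    omega
  refine ⟨e ⟨Z.rank - 1, hidx⟩, lt_of_le_of_ne (hnn _) (Ne.symm hpos), ?_, ?_⟩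
  · rw [kthEigenvalue, if_neg hk, dif_pos hidx]
  · intro i hi
    rw [heig] at hi ⊢
    refine hanti (Fin.le_def.2 ?_)
    have := hlt _ hi
    simp only
    omega

theorem Matrix.PosSemidef.eigenvalues_eq_zero_of_rank_eq_zero (hZ : Z.PosSemidef)
    (hk : Z.rank = 0) (i : Fin n) : hZ.1.eigenvalues i = 0 := by
  by_contra h
  rw [hZ.1.rank_eq_card_non_zero_eigs, Fintype.card_eq_zero_iff] at hk
  exact hk.false ⟨i, h⟩

end Spectral

/-! ### Quadratic growth -/

section Growth

variable {n m : ℕ} {A : Matrix (Fin n) (Fin n) ℝ →ₗ[ℝ] EuclideanSpace ℝ (Fin m)}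
  {Z Q X X₀ : Matrix (Fin n) (Fin n) ℝ} {α β M B ρ γ : ℝ}

/-- Quadratic growth in terms of `α` (an inverse bound for `A` on the symmetric matrices supported
on `ker Q`), `β` (the inverse of the spectral gap of `Z`) and `M` (a bound for `A`).

With `P = 1 - Q`, split `X - X₀ = D + E` into the orthogonal parts `D = P X P - X₀` and
`E = X - P X P`. The part `E` is controlled by `‖E‖² ≤ 2 ‖Q X‖² ≤ 2 B β ⟨Z, X⟩`, and the part `D`
by `‖D‖ ≤ α ‖A D‖ ≤ α (‖A (X - X₀)‖ + M ‖E‖)`. -/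
theorem quadratic_growth (hQ : IsOrthProj Q) (hα : 0 ≤ α) (hβ : 0 ≤ β) (hγ : 0 ≤ γ)
    (hD : ∀ D : Matrix (Fin n) (Fin n) ℝ, D.transpose = D → Q * D = 0 → ‖D‖ ≤ α * ‖A D‖)
    (hM : ∀ E : Matrix (Fin n) (Fin n) ℝ, E.transpose = E → ‖A E‖ ≤ M * ‖E‖)
    (hX : X.PosSemidef) (htr : X.trace ≤ B) (hZX : 0 ≤ frobInner Z X)
    (hgap : frobInner Q X ≤ β * frobInner Z X)
    (hX₀ : X₀.transpose = X₀) (hQX₀ : Q * X₀ = 0)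
    (h1 : γ * ((1 + 2 * M ^ 2 * α ^ 2) * (2 * B * β)) ≤ 1) (h2 : 4 * α ^ 2 * γ ≤ ρ) :
    γ * ‖X - X₀‖ ^ 2 ≤ frobInner Z X + ρ / 2 * ‖A X - A X₀‖ ^ 2 := by
  have hXt := hX.transpose_eq
  have hPt : (1 - Q).transpose = 1 - Q := hQ.compl.symm
  have hQP : Q * (1 - Q) = 0 := by rw [Matrix.mul_sub, hQ.idem]; simp
  obtain ⟨D, hDdef⟩ : ∃ D, D = (1 - Q) * X * (1 - Q) - X₀ := ⟨_, rfl⟩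
  obtain ⟨E, hEdef⟩ : ∃ E, E = X - (1 - Q) * X * (1 - Q) := ⟨_, rfl⟩
  have hDt : D.transpose = D := by
    rw [hDdef, Matrix.transpose_sub, Matrix.transpose_mul, Matrix.transpose_mul, hPt, hXt, hX₀,
      Matrix.mul_assoc]
  have hEt : E.transpose = E := by
    rw [hEdef, Matrix.transpose_sub, Matrix.transpose_mul, Matrix.transpose_mul, hPt, hXt,
      Matrix.mul_assoc]
  have hQD : Q * D = 0 := by
    rw [hDdef, Matrix.mul_sub, hQX₀, Matrix.mul_assoc, ← Matrix.mul_assoc Q, hQP]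
    simp
  have hDQ : D * Q = 0 := by
    rw [← Matrix.transpose_inj, Matrix.transpose_mul, hDt, hQ.symm, hQD, Matrix.transpose_zero]
  have hQE : Q * E = Q * X := by
    rw [hEdef, Matrix.mul_sub, Matrix.mul_assoc, ← Matrix.mul_assoc Q, hQP]
    simp
  have hPE : (1 - Q) * E = (1 - Q) * (X * Q) := by
    rw [hEdef, Matrix.mul_sub, Matrix.mul_assoc, hQ.compl.idem_assoc, ← Matrix.mul_sub]
    congr 1
    rw [Matrix.mul_sub]
    simp
  have hXQ : ‖X * Q‖ = ‖Q * X‖ := by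
    rw [← Matrix.frobenius_norm_transpose (X * Q), Matrix.transpose_mul, hQ.symm, hXt]
  have hE : ‖E‖ ^ 2 ≤ 2 * B * β * frobInner Z X := by
    have hle : ‖(1 - Q) * E‖ ≤ ‖Q * X‖ := by
      rw [hPE, ← hXQ]
      exact hQ.compl.norm_mul_le _
    have h3 := hQ.norm_mul_sq_le hX
    have h4 : frobInner Q X * X.trace ≤ β * frobInner Z X * B :=
      mul_le_mul hgap htr hX.trace_nonneg (by positivity)
    have h5 : ‖(1 - Q) * E‖ ^ 2 ≤ ‖Q * X‖ ^ 2 := by gcongr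
    rw [hQ.norm_sq_add E, hQE]
    linarith
  have hDE : frobInner D E = 0 := by
    have hPD : D = (1 - Q) * D := by rw [Matrix.sub_mul, hQD]; simp
    rw [hPD, frobInner_mul_left, hPt, hPE, frobInner_comm, ← Matrix.mul_assoc,
      frobInner_mul_right, hQ.symm, hDQ, frobInner_zero_right]
  have hsum : X - X₀ = D + E := by rw [hDdef, hEdef]; abel
  have hnorm : ‖X - X₀‖ ^ 2 = ‖D‖ ^ 2 + ‖E‖ ^ 2 := by
    rw [hsum, norm_add_sq_of_frobInner_eq_zero hDE]
  have hAD : ‖A D‖ ≤ ‖A X - A X₀‖ + M * ‖E‖ := by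
    have : A D = (A X - A X₀) - A E := by
      rw [← map_sub, hsum, map_add, add_sub_cancel_right]
    rw [this]
    exact (norm_sub_le _ _).trans (add_le_add le_rfl (hM E hEt))
  set a := ‖A X - A X₀‖ with ha
  have hDsq : ‖D‖ ^ 2 ≤ 2 * α ^ 2 * a ^ 2 + 2 * M ^ 2 * α ^ 2 * ‖E‖ ^ 2 := by
    have h3 : ‖D‖ ≤ α * (a + M * ‖E‖) :=
      (hD D hDt hQD).trans (mul_le_mul_of_nonneg_left hAD hα)
    have h4 : ‖D‖ ^ 2 ≤ (α * (a + M * ‖E‖)) ^ 2 := pow_le_pow_left₀ (norm_nonneg _) h3 2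
    nlinarith [mul_nonneg (sq_nonneg α) (sq_nonneg (a - M * ‖E‖))]
  rw [hnorm]
  have h5 : γ * ‖D‖ ^ 2 ≤ γ * (2 * α ^ 2 * a ^ 2 + 2 * M ^ 2 * α ^ 2 * ‖E‖ ^ 2) :=
    mul_le_mul_of_nonneg_left hDsq hγ
  have h6 : γ * (1 + 2 * M ^ 2 * α ^ 2) * ‖E‖ ^ 2 ≤
      γ * (1 + 2 * M ^ 2 * α ^ 2) * (2 * B * β * frobInner Z X) :=
    mul_le_mul_of_nonneg_left hE (by positivity)
  have h7 := mul_le_mul_of_nonneg_right h1 hZX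
  have h8 := mul_le_mul_of_nonneg_right h2 (sq_nonneg a)
  linarith

end Growth

/-! ### Extremal singular values -/

section Sigma

variable {d m : ℕ} (B : Matrix (Fin d) (Fin d) ℝ →ₗ[ℝ] EuclideanSpace ℝ (Fin m))

theorem sigmaMax_nonneg : 0 ≤ sigmaMax B :=
  Real.iSup_nonneg fun S => div_nonneg (norm_nonneg _) (norm_nonneg S.1)

theorem norm_le_sigmaMax_mul {S : Matrix (Fin d) (Fin d) ℝ} (hS : S.transpose = S) :
    ‖B S‖ ≤ sigmaMax B * ‖S‖ := by
  rcases eq_or_ne S 0 with rfl | h0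
  · simp
  have hbdd : BddAbove (Set.range fun S : {S : Matrix (Fin d) (Fin d) ℝ // S.IsSymm ∧ S ≠ 0} =>
      ‖B S.1‖ / frobNorm S.1) := by
    obtain ⟨C, -, hC⟩ := (LinearMap.toContinuousLinearMap B).bound
    refine ⟨C, ?_⟩
    rintro _ ⟨T, rfl⟩
    exact (div_le_iff₀ (norm_pos_iff.2 T.2.2)).2 (hC T.1)
  have := le_ciSup hbdd ⟨S, hS, h0⟩
  rwa [frobNorm_eq_norm, div_le_iff₀ (norm_pos_iff.2 h0)] at this

/-- For a map that is injective on symmetric matrices, `σ_min` is positive; it is a real number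
unless there is no nonzero symmetric matrix. -/
theorem sigmaMin_eq_top_or_pos
    (hB : ∀ S : Matrix (Fin d) (Fin d) ℝ, S.transpose = S → B S = 0 → S = 0) :
    (sigmaMin B = ⊤ ∧ d = 0) ∨ d ≠ 0 ∧ ∃ s : ℝ, 0 < s ∧ sigmaMin B = (s : EReal) ∧
      ∀ S : Matrix (Fin d) (Fin d) ℝ, S.transpose = S → s * ‖S‖ ≤ ‖B S‖ := by
  rcases Nat.eq_zero_or_pos d with rfl | hd
  · refine Or.inl ⟨?_, rfl⟩
    have : IsEmpty {S : Matrix (Fin 0) (Fin 0) ℝ // S.IsSymm ∧ S ≠ 0} :=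
      ⟨fun S => S.2.2 (Subsingleton.elim _ _)⟩
    exact iInf_of_empty _
  refine Or.inr ⟨hd.ne', ?_⟩
  -- The map `S ↦ (B (S + Sᵀ), S - Sᵀ)` is injective on all matrices.
  let τ : Matrix (Fin d) (Fin d) ℝ →ₗ[ℝ] Matrix (Fin d) (Fin d) ℝ :=
    (Matrix.transposeLinearEquiv (Fin d) (Fin d) ℝ ℝ).toLinearMap
  obtain ⟨K, hK, hanti⟩ := LinearMap.exists_antilipschitzWith
    ((B.comp (LinearMap.id + τ)).prod (LinearMap.id - τ)) (by
      rw [LinearMap.ker_eq_bot']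
      intro S hS
      replace hS : (B (S + S.transpose), S - S.transpose) = 0 := hS
      rw [Prod.mk_eq_zero] at hS
      have hSt : S.transpose = S := (sub_eq_zero.1 hS.2).symm
      have h2 := hS.1
      rw [hSt, ← two_smul ℝ S, map_smul, smul_eq_zero] at h2
      exact hB S hSt (h2.resolve_left two_ne_zero))
  have hK' : (0 : ℝ) < K := hK
  have hlow : ∀ S : Matrix (Fin d) (Fin d) ℝ, S.transpose = S →
      (2 * (K : ℝ))⁻¹ * ‖S‖ ≤ ‖B S‖ := by
    intro S hS
    have h := hanti.le_mul_dist S 0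
    rw [dist_zero_right, map_zero, dist_zero_right] at h
    replace h : ‖S‖ ≤ K * ‖(B (S + S.transpose), S - S.transpose)‖ := h
    rw [hS, sub_self, ← two_smul ℝ S, map_smul, Prod.norm_mk, norm_zero,
      max_eq_left (norm_nonneg _), norm_smul,
      Real.norm_two] at h
    rw [inv_mul_le_iff₀ (by positivity)]
    linarith
  set I : EReal := sigmaMin B with hI
  have h1 : (((2 * (K : ℝ))⁻¹ : ℝ) : EReal) ≤ I := by
    refine le_iInf fun S => EReal.coe_le_coe_iff.2 ?_
    rw [frobNorm_eq_norm, le_div_iff₀ (norm_pos_iff.2 S.2.2)]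
    exact hlow S.1 S.2.1
  have hne : (1 : Matrix (Fin d) (Fin d) ℝ) ≠ 0 := by
    have : Nonempty (Fin d) := ⟨⟨0, hd⟩⟩
    exact one_ne_zero
  have h2 : I ≤ _ := iInf_le _ (⟨1, Matrix.isSymm_one, hne⟩ :
    {S : Matrix (Fin d) (Fin d) ℝ // S.IsSymm ∧ S ≠ 0})
  have hreal : ((I.toReal : ℝ) : EReal) = I :=
    EReal.coe_toReal (h2.trans_lt (EReal.coe_lt_top _)).ne
      ((EReal.bot_lt_coe _).trans_le h1).ne'
  refine ⟨I.toReal, ?_, hreal.symm, ?_⟩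
  · rw [← hreal, EReal.coe_le_coe_iff] at h1
    exact lt_of_lt_of_le (by positivity) h1
  · intro S hS
    rcases eq_or_ne S 0 with rfl | h0
    · simp
    have h3 : I ≤ _ := iInf_le _ (⟨S, hS, h0⟩ :
      {S : Matrix (Fin d) (Fin d) ℝ // S.IsSymm ∧ S ≠ 0})
    rw [← hreal, EReal.coe_le_coe_iff, frobNorm_eq_norm, le_div_iff₀ (norm_pos_iff.2 h0)] at h3
    exact h3

/-- The extended-real growth constant, compared with real inverses `α` of `σ_min` and `β` of
the spectral gap, where the inverse of `⊤` is `0`. -/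
theorem exists_growth_constant {l s : EReal} {α β M B ρ : ℝ} (hB : 0 < B) (hρ : 0 < ρ)
    (hl : (l = ⊤ ∧ β = 0) ∨ ∃ x : ℝ, 0 < x ∧ l = (x : EReal) ∧ β = x⁻¹)
    (hs : (s = ⊤ ∧ α = 0) ∨ ∃ x : ℝ, 0 < x ∧ s = (x : EReal) ∧ α = x⁻¹)
    (hne : α ≠ 0 ∨ β ≠ 0) :
    ∃ γ : ℝ, 0 < γ ∧
      min (l / ((B : EReal) * (4 + 10 * ((M : EReal) / s) ^ 2))) ((ρ : EReal) * s ^ 2 / 10) ≤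
        (γ : EReal) ∧
      γ * (B * β * (4 + 10 * M ^ 2 * α ^ 2)) ≤ 1 ∧ 10 * α ^ 2 * γ ≤ ρ := by
  have h4 : (4 : EReal) = ((4 : ℝ) : EReal) := rfl
  have h10 : (10 : EReal) = ((10 : ℝ) : EReal) := rfl
  rcases hl with ⟨rfl, rfl⟩ | ⟨x, hx, rfl, rfl⟩ <;>
    rcases hs with ⟨rfl, rfl⟩ | ⟨y, hy, rfl, rfl⟩
  · simp at hne
  · refine ⟨ρ * y ^ 2 / 10, by positivity, (min_le_right _ _).trans ?_, by simp, ?_⟩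
    · rw [h10]
      exact_mod_cast le_rfl
    · apply le_of_eq
      field_simp
  · refine ⟨x / (B * 4), by positivity, (min_le_left _ _).trans ?_, ?_, by simpa using hρ.le⟩
    · rw [EReal.div_top, zero_pow two_ne_zero, mul_zero, add_zero, h4]
      exact_mod_cast le_rfl
    · apply le_of_eq
      field_simp
      ring
  · refine ⟨min (x / (B * (4 + 10 * (M / y) ^ 2))) (ρ * y ^ 2 / 10), by positivity, ?_, ?_, ?_⟩
    · rw [h4, h10]
      exact_mod_cast le_rfl
    · have : B * x⁻¹ * (4 + 10 * M ^ 2 * y⁻¹ ^ 2) =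
          (x / (B * (4 + 10 * (M / y) ^ 2)))⁻¹ := by
        field_simp
      rw [this, mul_inv_le_iff₀ (by positivity), one_mul]
      exact min_le_left _ _
    · have := min_le_right (x / (B * (4 + 10 * (M / y) ^ 2))) (ρ * y ^ 2 / 10)
      calc 10 * y⁻¹ ^ 2 * _ ≤ 10 * y⁻¹ ^ 2 * (ρ * y ^ 2 / 10) := by gcongr
        _ = ρ := by field_simp

end Sigma

/-! ### Optimality conditions for the augmented Lagrangian subproblem -/

namespace SDP

variable {n m : ℕ} (P : SDP n m) {ρ : ℝ} {y z ys : EuclideanSpace ℝ (Fin m)}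
  {X X' Xs : Matrix (Fin n) (Fin n) ℝ}

theorem Z_transpose (y : EuclideanSpace ℝ (Fin m)) : (P.Z y).transpose = P.Z y := by
  have := P.Z_isHermitian y
  rwa [Matrix.IsHermitian, Matrix.conjTranspose_eq_transpose_of_trivial] at this

theorem frobInner_Z (z : EuclideanSpace ℝ (Fin m)) (X : Matrix (Fin n) (Fin n) ℝ) :
    frobInner (P.Z z) X = frobInner P.C X - inner ℝ z (P.Amap X) := by
  rw [Z, frobInner_sub_left, inner_Amap]

/-- The slack is affine, hence Lipschitz. -/
theorem norm_Z_sub_le (z w : EuclideanSpace ℝ (Fin m)) :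
    ‖P.Z z - P.Z w‖ ≤ (∑ i, ‖P.A i‖) * ‖w - z‖ := by
  have : P.Z z - P.Z w = ∑ i, (w - z) i • P.A i := by
    simp only [Z, Aadj, PiLp.sub_apply, sub_smul, Finset.sum_sub_distrib]
    abel
  rw [this, Finset.sum_mul]
  refine norm_sum_le_of_le _ fun i _ => ?_
  rw [norm_smul, mul_comm]
  exact mul_le_mul_of_nonneg_left (PiLp.norm_apply_le _ i) (norm_nonneg _)

/-- Second-order expansion of the augmented Lagrangian; its gradient is `Z(y - ρ (𝓐 X - b))`. -/
theorem augLagrangian_add_smul (t : ℝ) (X D : Matrix (Fin n) (Fin n) ℝ) :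
    P.augLagrangian ρ (X + t • D) y = P.augLagrangian ρ X y +
      t * frobInner (P.Z (y - ρ • (P.Amap X - P.b))) D + ρ / 2 * t ^ 2 * ‖P.Amap D‖ ^ 2 := by
  have h : P.Amap (X + t • D) - P.b = (P.Amap X - P.b) + t • P.Amap D := by
    rw [map_add, map_smul]
    abel
  rw [augLagrangian, augLagrangian, ← neg_sub (P.Amap (X + t • D)), h, norm_add_sq_real,
    ← neg_sub (P.Amap X) P.b, frobInner_Z, frobInner_add_right, frobInner_smul_right]
  simp only [inner_neg_right, inner_add_right, inner_smul_right, inner_sub_left, inner_smul_left,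
    norm_smul, mul_pow, Real.norm_eq_abs, sq_abs, conj_trivial]
  ring

theorem ALKKT.eq_sub_smul {P : SDP n m} (hρ : 0 < ρ) (h : P.ALKKT ρ y X z) :
    z = y - ρ • (P.Amap X - P.b) := by
  rw [h.1, add_sub_cancel_right, smul_smul, mul_one_div_cancel hρ.ne', one_smul]
  abel

theorem ALKKT.frobInner_eq_zero {P : SDP n m} (h : P.ALKKT ρ y X z) :
    frobInner (P.Z z) X = 0 := by
  rw [frobInner, Z_transpose, h.2.1, Matrix.trace_zero]

/-- At a KKT pair, the suboptimality of `X'` is exactly `⟨Z(z), X'⟩ + ρ/2 ‖𝓐 X' - 𝓐 X‖²`. -/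
theorem ALKKT.augLagrangian_sub {P : SDP n m} (hρ : 0 < ρ) (h : P.ALKKT ρ y X z)
    (X' : Matrix (Fin n) (Fin n) ℝ) :
    P.augLagrangian ρ X' y - P.augLagrangian ρ X y =
      frobInner (P.Z z) X' + ρ / 2 * ‖P.Amap X' - P.Amap X‖ ^ 2 := by
  have := P.augLagrangian_add_smul (ρ := ρ) (y := y) 1 X (X' - X)
  rw [one_smul, add_sub_cancel, ← h.eq_sub_smul hρ, map_sub, frobInner_sub_right,
    h.frobInner_eq_zero] at this
  rw [this]
  ring

/-- First-order optimality over the cone: the gradient `Z(z)` lies in the dual cone and is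
orthogonal to `X`. -/
theorem ALPrimalOptimal.alKKT {P : SDP n m} (hρ : 0 < ρ) (h : P.ALPrimalOptimal ρ y X) :
    P.ALKKT ρ y X (y - ρ • (P.Amap X - P.b)) := by
  obtain ⟨hX, hmin⟩ := h
  set z := y - ρ • (P.Amap X - P.b) with hz
  have hvar : ∀ X' : Matrix (Fin n) (Fin n) ℝ, X'.PosSemidef →
      0 ≤ frobInner (P.Z z) (X' - X) := by
    intro X' hX'
    by_contra! hneg
    set g := frobInner (P.Z z) (X' - X) with hg
    set q := ρ / 2 * ‖P.Amap (X' - X)‖ ^ 2 with hq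
    have hq0 : 0 ≤ q := by positivity
    -- The step `t` makes the quadratic term smaller than the linear one.
    obtain ⟨t, ht0, ht1, htq⟩ : ∃ t : ℝ, 0 < t ∧ t ≤ 1 ∧ t * q < -g := by
      refine ⟨-g / (-g + q), div_pos (by linarith) (by linarith), ?_, ?_⟩
      · rw [div_le_one (by linarith)]
        linarith
      · rw [div_mul_eq_mul_div, div_lt_iff₀ (by linarith)]
        nlinarith
    have hpsd : (X + t • (X' - X)).PosSemidef := by
      have : X + t • (X' - X) = (1 - t) • X + t • X' := by
        rw [smul_sub, sub_smul, one_smul]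
        abel
      rw [this]
      exact (hX.smul (sub_nonneg.2 ht1)).add (hX'.smul ht0.le)
    have h1 := hmin _ hpsd
    rw [augLagrangian_add_smul, ← hz, ← hg] at h1
    have : t * (g + t * q) < 0 := mul_neg_of_pos_of_neg ht0 (by linarith)
    have h2 : ρ / 2 * t ^ 2 * ‖P.Amap (X' - X)‖ ^ 2 = t * (t * q) := by rw [hq]; ring
    linarith
  have h0 : frobInner (P.Z z) X = 0 := by
    have ha := hvar 0 Matrix.PosSemidef.zero
    have hb := hvar (X + X) (hX.add hX)
    rw [zero_sub, ← neg_one_smul ℝ X, frobInner_smul_right] at ha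
    rw [add_sub_cancel_right] at hb
    linarith
  have hZ : (P.Z z).PosSemidef := by
    refine Matrix.PosSemidef.of_frobInner_nonneg (P.Z_transpose z) fun Y hY => ?_
    have := hvar (X + Y) (hX.add hY)
    rwa [add_sub_cancel_left] at this
  refine ⟨?_, hZ.mul_eq_zero_of_frobInner_eq_zero hX h0, hX, hZ⟩
  rw [hz, sub_sub_cancel, smul_smul, one_div_mul_cancel hρ.ne', one_smul, sub_add_cancel]

/-- At a KKT pair, the dual suboptimality of `z'` is `⟨Z(z'), X⟩ + ‖z' - z‖² / (2ρ)`. -/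
theorem ALKKT.alDualObjective_sub {P : SDP n m} (hρ : 0 < ρ) (h : P.ALKKT ρ y X z)
    (z' : EuclideanSpace ℝ (Fin m)) :
    P.ALDualObjective ρ y z - P.ALDualObjective ρ y z' =
      frobInner (P.Z z') X + 1 / (2 * ρ) * ‖z' - z‖ ^ 2 := by
  have h0 := h.frobInner_eq_zero
  have hb : P.b = P.Amap X - (1 / ρ) • (y - z) := by rw [h.1, add_sub_cancel_left]
  rw [frobInner_Z] at h0 ⊢
  have e1 : z' - y = (z' - z) + (z - y) := by abel
  have e2 : inner ℝ (z' - z) (z - y) = - inner ℝ (y - z) (z' - z) := by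
    rw [real_inner_comm, ← inner_neg_left, neg_sub]
  rw [ALDualObjective, ALDualObjective, e1, norm_add_sq_real, e2, hb]
  simp only [inner_sub_left, inner_smul_left, conj_trivial, inner_sub_right]
    at h0 ⊢
  rw [real_inner_comm z (P.Amap X), real_inner_comm z' (P.Amap X)]
  field_simp
  linear_combination (-2 * ρ) * h0

theorem ALKKT.alDualOptimal {P : SDP n m} (hρ : 0 < ρ) (h : P.ALKKT ρ y X z) :
    P.ALDualOptimal ρ y z := by
  refine ⟨h.2.2.2, fun z' hz' => ?_⟩
  have h1 := h.alDualObjective_sub hρ z'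
  have h2 : 0 ≤ frobInner (P.Z z') X := Matrix.PosSemidef.frobInner_nonneg hz' h.2.2.1
  have : 0 ≤ 1 / (2 * ρ) * ‖z' - z‖ ^ 2 := by positivity
  linarith

theorem ALKKT.eq_of_alDualOptimal {P : SDP n m} (hρ : 0 < ρ) (h : P.ALKKT ρ y X z)
    {z' : EuclideanSpace ℝ (Fin m)} (hz' : P.ALDualOptimal ρ y z') : z' = z := by
  have h1 := h.alDualObjective_sub hρ z'
  have h2 : 0 ≤ frobInner (P.Z z') X := Matrix.PosSemidef.frobInner_nonneg hz'.1 h.2.2.1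
  have h3 := hz'.2 z h.2.2.2
  have h4 : 1 / (2 * ρ) * ‖z' - z‖ ^ 2 ≤ 0 := by linarith
  have h5 : ‖z' - z‖ ^ 2 ≤ 0 := nonpos_of_mul_nonpos_right h4 (by positivity)
  have h6 : ‖z' - z‖ = 0 := by nlinarith [norm_nonneg (z' - z)]
  exact sub_eq_zero.1 (norm_eq_zero.1 h6)

/-- All optimal pairs of the subproblem and its dual satisfy the KKT conditions. -/
theorem ALPrimalOptimal.alKKT_of_alDualOptimal {P : SDP n m} (hρ : 0 < ρ)
    (hX : P.ALPrimalOptimal ρ y X) (hz : P.ALDualOptimal ρ y z) : P.ALKKT ρ y X z := by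
  rw [(hX.alKKT hρ).eq_of_alDualOptimal hρ hz]
  exact hX.alKKT hρ

/-- Dual Slater bounds the trace of a positive semidefinite matrix by a linear functional. -/
theorem trace_le_mul_of_posDef {Z : Matrix (Fin n) (Fin n) ℝ} (hZ : Z.PosDef) :
    ∃ β : ℝ, 0 ≤ β ∧ ∀ X : Matrix (Fin n) (Fin n) ℝ, X.PosSemidef →
      X.trace ≤ β * frobInner Z X := by
  obtain ⟨Q, G, -, hZQ, -, hβ⟩ := hZ.1.exists_range_projection
  have hQ1 : Q = 1 := hZ.isUnit.mul_left_cancel (by rw [hZQ, mul_one])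
  have hpos := hZ.eigenvalues_pos
  refine ⟨∑ i, (hZ.1.eigenvalues i)⁻¹, Finset.sum_nonneg fun i _ => (inv_pos.2 (hpos i)).le,
    fun X hX => ?_⟩
  have h := hβ (∑ i, (hZ.1.eigenvalues i)⁻¹) fun i _ => by
    rw [← inv_mul_cancel₀ (hpos i).ne']
    exact mul_le_mul_of_nonneg_right (Finset.single_le_sum
      (f := fun i => (hZ.1.eigenvalues i)⁻¹) (fun j _ => (inv_pos.2 (hpos j)).le)
      (Finset.mem_univ i)) (hpos i).le
  have h' := h.frobInner_nonneg hX
  rw [frobInner_sub_left, frobInner_smul_left, hQ1, frobInner_one_left] at h'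
  linarith

theorem isCompact_posSemidef_trace_le (R : ℝ) :
    IsCompact {X : Matrix (Fin n) (Fin n) ℝ | X.PosSemidef ∧ X.trace ≤ R} := by
  have : ProperSpace (Matrix (Fin n) (Fin n) ℝ) := FiniteDimensional.proper ℝ _
  have heq : {X : Matrix (Fin n) (Fin n) ℝ | X.PosSemidef ∧ X.trace ≤ R} =
      {X | X.transpose = X} ∩ ({X | ∀ Y : Matrix (Fin n) (Fin n) ℝ, Y.PosSemidef →
        0 ≤ (X.transpose * Y).trace} ∩ {X | X.trace ≤ R}) := by
    ext X
    constructor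
    · rintro ⟨h1, h2⟩
      exact ⟨h1.transpose_eq, fun Y hY => h1.frobInner_nonneg hY, h2⟩
    · rintro ⟨h1, h2, h3⟩
      exact ⟨Matrix.PosSemidef.of_frobInner_nonneg h1 h2, h3⟩
  refine Metric.isCompact_of_isClosed_isBounded ?_ ?_
  · rw [heq]
    refine (isClosed_eq (by fun_prop) continuous_id).inter (IsClosed.inter ?_
      (isClosed_le (by fun_prop) continuous_const))
    simp only [Set.ofPred_forall]
    exact isClosed_iInter fun Y => isClosed_iInter fun _ =>
      isClosed_le continuous_const (by fun_prop)
  · rw [Metric.isBounded_iff_subset_closedBall 0]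
    refine ⟨R, fun X hX => ?_⟩
    rw [mem_closedBall_zero_iff]
    exact hX.1.norm_le_trace.trans hX.2

/-- Under dual Slater the augmented Lagrangian is coercive on the cone, so the subproblem has a
solution. -/
theorem exists_alPrimalOptimal (hS : P.DualSlater) (hρ : 0 < ρ) (y : EuclideanSpace ℝ (Fin m)) :
    ∃ X, P.ALPrimalOptimal ρ y X := by
  obtain ⟨y₀, hy₀⟩ := hS
  obtain ⟨β, hβ, htr⟩ := trace_le_mul_of_posDef hy₀
  set κ := inner ℝ y₀ P.b - 1 / (2 * ρ) * ‖y₀ - y‖ ^ 2 with hκ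
  have hlow : ∀ X, frobInner (P.Z y₀) X + κ ≤ P.augLagrangian ρ X y := by
    intro X
    have h1 : P.augLagrangian ρ X y = frobInner (P.Z y₀) X + inner ℝ y₀ P.b +
        inner ℝ (y₀ - y) (P.Amap X - P.b) + ρ / 2 * ‖P.Amap X - P.b‖ ^ 2 := by
      rw [augLagrangian, frobInner_Z]
      simp only [inner_sub_left, inner_sub_right]
      ring
    have h2 := norm_add_sq_real (y₀ - y) (ρ • (P.Amap X - P.b))
    rw [inner_smul_right, norm_smul, Real.norm_eq_abs, mul_pow, sq_abs] at h2
    have h3 : 0 ≤ 1 / (2 * ρ) * ‖(y₀ - y) + ρ • (P.Amap X - P.b)‖ ^ 2 := by positivity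
    rw [h2] at h3
    have h4 : 1 / (2 * ρ) * (‖y₀ - y‖ ^ 2 + 2 * (ρ * inner ℝ (y₀ - y) (P.Amap X - P.b)) +
        ρ ^ 2 * ‖P.Amap X - P.b‖ ^ 2) = 1 / (2 * ρ) * ‖y₀ - y‖ ^ 2 +
        inner ℝ (y₀ - y) (P.Amap X - P.b) + ρ / 2 * ‖P.Amap X - P.b‖ ^ 2 := by
      field_simp
    linarith
  have hcont : Continuous fun X => P.augLagrangian ρ X y := by
    have hA : Continuous P.Amap := LinearMap.continuous_of_finiteDimensional _
    unfold augLagrangian frobInner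
    fun_prop
  have hzero := hlow 0
  rw [frobInner_zero_right, zero_add] at hzero
  obtain ⟨X, hXK, hXmin⟩ := (isCompact_posSemidef_trace_le (n := n)
    (β * (P.augLagrangian ρ 0 y - κ))).exists_isMinOn
      ⟨0, Matrix.PosSemidef.zero, by
        rw [Matrix.trace_zero]
        exact mul_nonneg hβ (sub_nonneg.2 hzero)⟩ hcont.continuousOn
  refine ⟨X, hXK.1, fun X' hX' => ?_⟩
  by_cases hK : X'.trace ≤ β * (P.augLagrangian ρ 0 y - κ)
  · exact hXmin ⟨hX', hK⟩
  · have h1 : P.augLagrangian ρ X y ≤ P.augLagrangian ρ 0 y :=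
      hXmin ⟨Matrix.PosSemidef.zero, by
        rw [Matrix.trace_zero]
        exact mul_nonneg hβ (sub_nonneg.2 hzero)⟩
    have h2 := lt_of_mul_lt_mul_left ((not_le.1 hK).trans_le (htr X' hX')) hβ
    linarith [hlow X']

/-- The dual solution map is a proximal map that fixes `ys`, hence it does not move points further
away from `ys`. -/
theorem ALKKT.norm_sub_le {P : SDP n m} (hρ : 0 < ρ) (h : P.ALKKT ρ y X z)
    (hXs : P.PrimalFeasible Xs) (hys : (P.Z ys).PosSemidef) (hc : frobInner (P.Z ys) Xs = 0) :
    ‖z - ys‖ ≤ ‖y - ys‖ := by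
  have h1 := h.2.2.2.frobInner_nonneg hXs.2
  have h2 := hys.frobInner_nonneg h.2.2.1
  have h0 := h.frobInner_eq_zero
  have hA : P.Amap X = P.Amap Xs + (1 / ρ) • (y - z) := by rw [h.1, hXs.1, add_comm]
  have h3 : 0 ≤ inner ℝ (z - ys) (y - z) := by
    have : inner ℝ (z - ys) (P.Amap X - P.Amap Xs) =
        frobInner (P.Z ys) X + frobInner (P.Z z) Xs := by
      rw [frobInner_Z] at hc h0 ⊢
      rw [frobInner_Z]
      simp only [inner_sub_left, inner_sub_right]
      linarith
    rw [hA, add_sub_cancel_left, inner_smul_right] at this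
    have h4 : 0 ≤ 1 / ρ * inner ℝ (z - ys) (y - z) := by rw [this]; exact add_nonneg h2 h1
    exact nonneg_of_mul_nonneg_right h4 (by positivity)
  have e : y - z = (y - ys) - (z - ys) := by abel
  rw [e, inner_sub_right, real_inner_self_eq_norm_sq] at h3
  have h4 := real_inner_le_norm (z - ys) (y - ys)
  rcases (norm_nonneg (z - ys)).eq_or_lt with h5 | h5
  · rw [← h5]
    exact norm_nonneg _
  · exact le_of_mul_le_mul_left (by nlinarith) h5

end SDP

/-! ### Stability of the growth data under perturbation -/

section Perturbation

variable {n m : ℕ} {A : Matrix (Fin n) (Fin n) ℝ →ₗ[ℝ] EuclideanSpace ℝ (Fin m)}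
  {Z Z' Q Q' X X' G : Matrix (Fin n) (Fin n) ℝ} {α β M : ℝ}

/-- The gap bound `Q ≤ β Z` survives, with `5/4 β`, at a complementary pair `(X', Z')` near
`(X, Z)`. Matrices `W` in the range of `Q'` are nearly in the range of `Q`: since `Q' X' = 0`,
`Q' (1 - Q) = Q' (X - X') G` is small. -/
theorem frobInner_proj_le_of_perturb (hQ : IsOrthProj Q) (hβ : 0 ≤ β)
    (hgap : (β • Z - Q).PosSemidef) (hXG : X * G = 1 - Q)
    (hZ' : Z'.transpose = Z') (hQ' : IsOrthProj Q') (hZQ' : Z' * Q' = Z') (hQX' : Q' * X' = 0)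
    (hZZ : 10 * β * ‖Z - Z'‖ ≤ 1) (hXX : 4 * ‖G‖ * ‖X - X'‖ ≤ 1)
    {Y : Matrix (Fin n) (Fin n) ℝ} (hY : Y.PosSemidef) :
    frobInner Q' Y ≤ 5 / 4 * β * frobInner Z' Y := by
  obtain ⟨R, rfl⟩ := hY.exists_eq_mul_transpose
  have hQZ' : Q' * Z' = Z' := by
    rw [← Matrix.transpose_inj, Matrix.transpose_mul, hZ', hQ'.symm, hZQ']
  obtain ⟨W, hW⟩ : ∃ W, W = Q' * R := ⟨_, rfl⟩
  have hQW : Q' * W = W := by rw [hW, hQ'.idem_assoc]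
  have h1 : frobInner Q' (R * R.transpose) = ‖W‖ ^ 2 := by
    rw [frobInner_mul_transpose, norm_sq_eq_frobInner, hW, frobInner_mul_left, hQ'.symm,
      hQ'.idem_assoc]
  have h2 : frobInner Z' (R * R.transpose) = frobInner W (Z' * W) := by
    rw [frobInner_mul_transpose, hW, frobInner_mul_left, hQ'.symm, ← Matrix.mul_assoc Z', hZQ',
      ← Matrix.mul_assoc, hQZ']
  have h3 : ‖Q * W‖ ^ 2 ≤ β * frobInner W (Z * W) := by
    have h := hgap.frobInner_mul_nonneg W
    have h' : ‖Q * W‖ ^ 2 = frobInner W (Q * W) := by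
      rw [norm_sq_eq_frobInner, frobInner_mul_left, hQ.symm, hQ.idem_assoc]
    rw [Matrix.sub_mul, Matrix.smul_mul, frobInner_sub_right, frobInner_smul_right] at h
    linarith
  have h4 : frobInner W (Z * W) ≤ frobInner W (Z' * W) + ‖Z - Z'‖ * ‖W‖ ^ 2 := by
    have ha := frobInner_le_norm_mul_norm W ((Z - Z') * W)
    have hb := mul_le_mul_of_nonneg_left (Matrix.frobenius_norm_mul (Z - Z') W) (norm_nonneg W)
    rw [Matrix.sub_mul, frobInner_sub_right] at ha
    rw [Matrix.sub_mul] at hb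
    nlinarith
  have h5 : ‖(1 - Q) * W‖ ≤ 1 / 4 * ‖W‖ := by
    have hsmall : ‖Q' * (1 - Q)‖ ≤ 1 / 4 := by
      have : Q' * (1 - Q) = Q' * ((X - X') * G) := by
        rw [← hXG, Matrix.sub_mul, Matrix.mul_sub, ← Matrix.mul_assoc Q' X', hQX']
        simp
      rw [this]
      refine (hQ'.norm_mul_le _).trans ((Matrix.frobenius_norm_mul _ _).trans ?_)
      linarith
    have ht : (1 - Q) * W = (Q' * (1 - Q)).transpose * W := by
      rw [Matrix.transpose_mul, hQ'.symm, hQ.compl.symm, Matrix.mul_assoc, hQW]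
    rw [ht]
    refine (Matrix.frobenius_norm_mul _ _).trans ?_
    rw [Matrix.frobenius_norm_transpose]
    exact mul_le_mul_of_nonneg_right hsmall (norm_nonneg _)
  have h6 : ‖(1 - Q) * W‖ ^ 2 ≤ (1 / 4 * ‖W‖) ^ 2 := by gcongr
  have h7 := mul_le_mul_of_nonneg_left h4 hβ
  have h8 := mul_le_mul_of_nonneg_right hZZ (sq_nonneg ‖W‖)
  have h9 := hQ.norm_sq_add W
  rw [h1, h2]
  nlinarith [sq_nonneg ‖W‖]

/-- The inverse bound for `A` on symmetric matrices supported on `ker Z` survives, with `4/3 α`,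
on those supported on `ker Z'` for `Z'` near `Z`: if `Z' D = 0`, then `Q D = G (Z - Z') D` is
small, so `D` is close to its compression `(1 - Q) D (1 - Q)`. -/
theorem norm_le_of_perturb (hQ : IsOrthProj Q) (hα : 0 ≤ α) (hM₀ : 0 ≤ M) (hGZ : G * Z = Q)
    (hD : ∀ D : Matrix (Fin n) (Fin n) ℝ, D.transpose = D → Q * D = 0 → ‖D‖ ≤ α * ‖A D‖)
    (hM : ∀ E : Matrix (Fin n) (Fin n) ℝ, E.transpose = E → ‖A E‖ ≤ M * ‖E‖)
    (hZZ : 8 * ‖G‖ * (1 + α * M) * ‖Z - Z'‖ ≤ 1)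
    {D : Matrix (Fin n) (Fin n) ℝ} (hDt : D.transpose = D) (hZD : Z' * D = 0) :
    ‖D‖ ≤ 4 / 3 * α * ‖A D‖ := by
  set θ := ‖G‖ * ‖Z - Z'‖ with hθ
  have hPt : (1 - Q).transpose = 1 - Q := hQ.compl.symm
  have hQD : ‖Q * D‖ ≤ θ * ‖D‖ := by
    have : Q * D = G * ((Z - Z') * D) := by
      rw [Matrix.sub_mul, hZD, sub_zero, ← hGZ, Matrix.mul_assoc]
    rw [this, hθ, mul_assoc]
    exact (Matrix.frobenius_norm_mul _ _).trans
      (mul_le_mul_of_nonneg_left (Matrix.frobenius_norm_mul _ _) (norm_nonneg _))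
  have hDQ : ‖D * Q‖ = ‖Q * D‖ := by
    rw [← Matrix.frobenius_norm_transpose (D * Q), Matrix.transpose_mul, hQ.symm, hDt]
  obtain ⟨D', hD'⟩ : ∃ D', D' = (1 - Q) * D * (1 - Q) := ⟨_, rfl⟩
  have hD't : D'.transpose = D' := by
    rw [hD', Matrix.transpose_mul, Matrix.transpose_mul, hPt, hDt, Matrix.mul_assoc]
  have hQD' : Q * D' = 0 := by
    rw [hD', ← Matrix.mul_assoc, ← Matrix.mul_assoc, Matrix.mul_sub Q, hQ.idem]
    simp
  have hdiff : D - D' = Q * D + (1 - Q) * (D * Q) := by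
    rw [hD']
    noncomm_ring
  have hnorm : ‖D - D'‖ ≤ 2 * θ * ‖D‖ := by
    rw [hdiff]
    have := hQ.compl.norm_mul_le (D * Q)
    linarith [norm_add_le (Q * D) ((1 - Q) * (D * Q))]
  have h1 := hD D' hD't hQD'
  have h2 : ‖A D'‖ ≤ ‖A D‖ + M * ‖D - D'‖ := by
    have : A D' = A D - A (D - D') := by rw [map_sub]; abel
    rw [this]
    refine (norm_sub_le _ _).trans (add_le_add le_rfl (hM _ ?_))
    rw [Matrix.transpose_sub, hDt, hD't]
  have h3 : ‖D‖ ≤ ‖D'‖ + ‖D - D'‖ := by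
    have := norm_add_le D' (D - D')
    rwa [add_sub_cancel] at this
  have h4 := mul_le_mul_of_nonneg_left h2 hα
  have h5 := mul_le_mul_of_nonneg_left hnorm (show 0 ≤ 1 + α * M by positivity)
  have h6 : 8 * (1 + α * M) * θ * ‖D‖ ≤ 1 * ‖D‖ := by
    refine mul_le_mul_of_nonneg_right ?_ (norm_nonneg _)
    rw [hθ]
    linarith
  nlinarith

end Perturbation

/-! ### The nominal pair -/

section Nominal

variable {n r : ℕ} {Z X : Matrix (Fin n) (Fin n) ℝ} {V : Matrix (Fin n) (Fin r) ℝ}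

theorem mul_eq_zero_of_range_eq_ker
    (hV : LinearMap.range V.mulVecLin = LinearMap.ker Z.mulVecLin) : Z * V = 0 := by
  refine Matrix.ext_of_mulVec_single fun i => ?_
  have h : V.mulVecLin (Pi.single i 1) ∈ LinearMap.ker Z.mulVecLin := hV ▸ ⟨_, rfl⟩
  rw [LinearMap.mem_ker, Matrix.mulVecLin_apply, Matrix.mulVecLin_apply, Matrix.mulVec_mulVec] at h
  rw [h, Matrix.zero_mulVec]

theorem mul_transpose_mul_of_mul_eq_zero (hVV : V.transpose * V = 1)
    (hV : LinearMap.range V.mulVecLin = LinearMap.ker Z.mulVecLin) (hZX : Z * X = 0) :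
    V * V.transpose * X = X := by
  refine Matrix.ext_of_mulVec_single fun i => ?_
  have h : X.mulVecLin (Pi.single i 1) ∈ LinearMap.range V.mulVecLin := by
    rw [hV, LinearMap.mem_ker, Matrix.mulVecLin_apply, Matrix.mulVecLin_apply,
      Matrix.mulVec_mulVec, hZX, Matrix.zero_mulVec]
  obtain ⟨w, hw⟩ := h
  rw [Matrix.mulVecLin_apply, Matrix.mulVecLin_apply] at hw
  rw [← Matrix.mulVec_mulVec, ← hw, Matrix.mulVec_mulVec, Matrix.mul_assoc, hVV, Matrix.mul_one]

theorem norm_conj_of_orthonormal (hVV : V.transpose * V = 1) (S : Matrix (Fin r) (Fin r) ℝ) :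
    ‖V * S * V.transpose‖ = ‖S‖ := by
  refine (sq_eq_sq₀ (norm_nonneg _) (norm_nonneg _)).1 ?_
  rw [norm_sq_eq_trace, norm_sq_eq_trace]
  have : (V * S * V.transpose).transpose * (V * S * V.transpose) =
      V * (S.transpose * S) * V.transpose := by
    simp only [Matrix.transpose_mul, Matrix.transpose_transpose, Matrix.mul_assoc]
    rw [← Matrix.mul_assoc V.transpose V, hVV, Matrix.one_mul]
  rw [this, Matrix.trace_mul_comm, ← Matrix.mul_assoc, hVV, Matrix.one_mul]

theorem isUnit_of_rank_eq {S : Matrix (Fin r) (Fin r) ℝ} (h : r ≤ S.rank) : IsUnit S := by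
  rw [← Matrix.mulVec_surjective_iff_isUnit]
  have : LinearMap.range S.mulVecLin = ⊤ := by
    refine Submodule.eq_top_of_finrank_eq (le_antisymm (Submodule.finrank_le _) ?_)
    rwa [Module.finrank_fin_fun]
  exact LinearMap.range_eq_top.1 this

/-- A positive definite matrix stays positive semidefinite under small symmetric perturbations. -/
theorem Matrix.PosDef.exists_add_smul_posSemidef {S T : Matrix (Fin r) (Fin r) ℝ} (hS : S.PosDef)
    (hT : T.transpose = T) : ∃ t : ℝ, 0 < t ∧ (S + t • T).PosSemidef := by
  obtain ⟨β, hβ, htr⟩ := SDP.trace_le_mul_of_posDef hS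
  have hpos : 0 < β * ‖T‖ + 1 := by positivity
  refine ⟨(β * ‖T‖ + 1)⁻¹, by positivity,
    Matrix.PosSemidef.of_frobInner_nonneg ?_ fun Y hY => ?_⟩
  · rw [Matrix.transpose_add, Matrix.transpose_smul, hT, hS.posSemidef.transpose_eq]
  · have h1 := frobInner_le_norm_mul_norm (-T) Y
    have h2 := mul_le_mul_of_nonneg_left (hY.norm_le_trace.trans (htr Y hY)) (norm_nonneg T)
    have h3 := hS.posSemidef.frobInner_nonneg hY
    rw [norm_neg, ← neg_one_smul ℝ T, frobInner_smul_left] at h1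
    rw [frobInner_add_left, frobInner_smul_left]
    have h4 : 0 ≤ (β * ‖T‖ + 1)⁻¹ *
        ((β * ‖T‖ + 1) * frobInner S Y + frobInner T Y) :=
      mul_nonneg (by positivity) (by linarith)
    rwa [mul_add, inv_mul_cancel_left₀ hpos.ne'] at h4

end Nominal

namespace SDP

variable {n m : ℕ} {P : SDP n m} {Xs : Matrix (Fin n) (Fin n) ℝ} {ys : EuclideanSpace ℝ (Fin m)}

theorem StrictComplementaryPair.frobInner_eq_zero (h : P.StrictComplementaryPair Xs ys) :
    frobInner (P.Z ys) Xs = 0 := by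
  rw [frobInner_Z, h.1.1.1, h.2.2.1, real_inner_comm, sub_self]

theorem StrictComplementaryPair.mul_eq_zero (h : P.StrictComplementaryPair Xs ys) :
    P.Z ys * Xs = 0 :=
  Matrix.PosSemidef.mul_eq_zero_of_frobInner_eq_zero h.2.1.1 h.1.1.2 h.frobInner_eq_zero

/-- Compressing the primal solution to the null space of the dual slack gives a positive definite
matrix: this is strict complementarity. -/
theorem StrictComplementaryPair.exists_posDef_factor {Vs : Matrix (Fin n) (Fin Xs.rank) ℝ}
    (h : P.StrictComplementaryPair Xs ys) (hVV : Vs.transpose * Vs = 1)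
    (hV : LinearMap.range Vs.mulVecLin = LinearMap.ker (P.Z ys).mulVecLin) :
    ∃ S : Matrix (Fin Xs.rank) (Fin Xs.rank) ℝ, S.PosDef ∧ Xs = Vs * S * Vs.transpose := by
  have hX := h.1.1.2
  have h1 := mul_transpose_mul_of_mul_eq_zero hVV hV h.mul_eq_zero
  have h2 : Xs * (Vs * Vs.transpose) = Xs := by
    rw [← Matrix.transpose_inj, Matrix.transpose_mul, hX.transpose_eq, Matrix.transpose_mul,
      Matrix.transpose_transpose, h1]
  have hS : Xs = Vs * (Vs.transpose * Xs * Vs) * Vs.transpose := by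
    calc Xs = Vs * Vs.transpose * Xs * (Vs * Vs.transpose) := by rw [h1, h2]
      _ = _ := by simp only [Matrix.mul_assoc]
  have hpsd : (Vs.transpose * Xs * Vs).PosSemidef := by
    have := hX.conjTranspose_mul_mul_same Vs
    rwa [Matrix.conjTranspose_eq_transpose_of_trivial] at this
  refine ⟨_, hpsd.posDef_iff_isUnit.2 (isUnit_of_rank_eq ?_), hS⟩
  conv_lhs => rw [hS]
  exact (Matrix.rank_mul_le_left _ _).trans (Matrix.rank_mul_le_right _ _)

/-- Primal uniqueness makes `𝓐` injective on symmetric matrices supported on the null space of the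
dual slack: a kernel element is a direction along which the primal solution could be moved. -/
theorem StrictComplementaryPair.eq_zero_of_restrictMap_eq_zero
    {Vs : Matrix (Fin n) (Fin Xs.rank) ℝ} (huniq : ∃! X, P.PrimalOptimal X)
    (h : P.StrictComplementaryPair Xs ys) (hVV : Vs.transpose * Vs = 1)
    (hV : LinearMap.range Vs.mulVecLin = LinearMap.ker (P.Z ys).mulVecLin)
    (T : Matrix (Fin Xs.rank) (Fin Xs.rank) ℝ) (hT : T.transpose = T)
    (hAT : restrictMap P.Amap Vs T = 0) : T = 0 := by
  obtain ⟨S, hS, hXs⟩ := h.exists_posDef_factor hVV hV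
  obtain ⟨t, ht, hpsd⟩ := hS.exists_add_smul_posSemidef hT
  have hAT' : P.Amap (Vs * T * Vs.transpose) = 0 := hAT
  set T' := Vs * T * Vs.transpose with hT'
  have hobj : frobInner P.C T' = 0 := by
    have h1 := P.frobInner_Z ys T'
    have h2 : P.Z ys * T' = 0 := by
      rw [hT', ← Matrix.mul_assoc, ← Matrix.mul_assoc, mul_eq_zero_of_range_eq_ker hV]
      simp
    rw [hAT', inner_zero_right, sub_zero, frobInner, Z_transpose, h2, Matrix.trace_zero] at h1
    exact h1.symm
  have hpsd' : (Xs + t • T').PosSemidef := by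
    have h1 := hpsd.mul_mul_conjTranspose_same Vs
    rw [Matrix.conjTranspose_eq_transpose_of_trivial, Matrix.mul_add, Matrix.add_mul, ← hXs,
      Matrix.mul_smul, Matrix.smul_mul] at h1
    exact h1
  have hopt : P.PrimalOptimal (Xs + t • T') := by
    refine ⟨⟨?_, hpsd'⟩, fun X' hX' => ?_⟩
    · rw [map_add, map_smul, hAT', smul_zero, add_zero, h.1.1.1]
    · rw [frobInner_add_right, frobInner_smul_right, hobj, mul_zero, add_zero]
      exact h.1.2 X' hX'
  have h0 : t • T' = 0 := by
    have := huniq.unique hopt h.1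
    rwa [add_eq_left] at this
  have h1 : ‖T'‖ = 0 := by
    rw [norm_eq_zero]
    exact (smul_eq_zero.1 h0).resolve_left ht.ne'
  rw [hT', norm_conj_of_orthonormal hVV] at h1
  exact norm_eq_zero.1 h1

/-- The data at the nominal pair that drive all estimates: the projection `Q` onto the range of
the dual slack, partial inverses `GZ` and `GX` of the slack and of the primal solution, and the
constants `α` (inverse of `σ_min(𝓐_V)`, or `0` for `r = 0`) and `β` (inverse of `λ_{n-r}`, or `0`
for `r = n`). -/
theorem StrictComplementaryPair.exists_growth_data (hn : 0 < n)
    {Vs : Matrix (Fin n) (Fin Xs.rank) ℝ} (huniq : ∃! X, P.PrimalOptimal X)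
    (h : P.StrictComplementaryPair Xs ys) (hVV : Vs.transpose * Vs = 1)
    (hV : LinearMap.range Vs.mulVecLin = LinearMap.ker (P.Z ys).mulVecLin) :
    ∃ (Q GZ GX : Matrix (Fin n) (Fin n) ℝ) (α β : ℝ), IsOrthProj Q ∧ GZ * P.Z ys = Q ∧
      P.Z ys * (GZ * P.Z ys) = P.Z ys ∧ Q * Xs = 0 ∧ Xs * GX = 1 - Q ∧
      Xs * (GX * Xs) = Xs ∧ 0 ≤ α ∧ 0 ≤ β ∧
      (∀ D : Matrix (Fin n) (Fin n) ℝ, D.transpose = D → Q * D = 0 → ‖D‖ ≤ α * ‖P.Amap D‖) ∧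
      (β • P.Z ys - Q).PosSemidef ∧
      ∀ ρ B : ℝ, 0 < ρ → 0 < B → ∃ γ : ℝ, 0 < γ ∧ P.growthBound ys Vs ρ B ≤ (γ : EReal) ∧
        γ * (B * β * (4 + 10 * sigmaMax P.Amap ^ 2 * α ^ 2)) ≤ 1 ∧ 10 * α ^ 2 * γ ≤ ρ := by
  have hZ : (P.Z ys).PosSemidef := h.2.1.1
  obtain ⟨Q, GZ, hQ, hZQ, hGZ, hgap⟩ := hZ.1.exists_range_projection
  obtain ⟨S, hS, hXs⟩ := h.exists_posDef_factor hVV hV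
  have hQV : Q * Vs = 0 := by
    rw [← hGZ, Matrix.mul_assoc, mul_eq_zero_of_range_eq_ker hV, Matrix.mul_zero]
  have hQP : 1 - Q = Vs * Vs.transpose := by
    have h1 : Vs * Vs.transpose * (1 - Q) = 1 - Q := by
      refine mul_transpose_mul_of_mul_eq_zero hVV hV ?_
      rw [Matrix.mul_sub, hZQ, Matrix.mul_one, sub_self]
    have h2 : Vs.transpose * Q = 0 := by
      rw [← Matrix.transpose_inj, Matrix.transpose_mul, hQ.symm, Matrix.transpose_transpose, hQV,
        Matrix.transpose_zero]
    rw [← h1, Matrix.mul_sub, Matrix.mul_assoc Vs _ Q, h2]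
    simp
  have hQX : Q * Xs = 0 := by rw [← hGZ, Matrix.mul_assoc, h.mul_eq_zero, Matrix.mul_zero]
  have hXG : Xs * (Vs * S⁻¹ * Vs.transpose) = 1 - Q := by
    have hSS : S * S⁻¹ = 1 := Matrix.mul_nonsing_inv _ ((Matrix.isUnit_iff_isUnit_det _).1 hS.isUnit)
    have : ∀ T : Matrix (Fin Xs.rank) (Fin Xs.rank) ℝ,
        Vs * T * Vs.transpose * (Vs * S⁻¹ * Vs.transpose) = Vs * (T * S⁻¹) * Vs.transpose := by
      intro T
      simp only [Matrix.mul_assoc]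
      rw [← Matrix.mul_assoc Vs.transpose Vs, hVV, Matrix.one_mul]
    rw [hQP]
    refine (congrArg (· * (Vs * S⁻¹ * Vs.transpose)) hXs).trans ?_
    rw [this S, hSS, Matrix.mul_one]
  have hXGX : Xs * (Vs * S⁻¹ * Vs.transpose * Xs) = Xs := by
    rw [← Matrix.mul_assoc, hXG, Matrix.sub_mul, hQX]
    simp
  obtain ⟨α, hα, hσ⟩ : ∃ α : ℝ, ((sigmaMin (restrictMap P.Amap Vs) = ⊤ ∧ α = 0) ∨
      ∃ x : ℝ, 0 < x ∧ sigmaMin (restrictMap P.Amap Vs) = (x : EReal) ∧ α = x⁻¹) ∧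
      (α = 0 → Xs.rank = 0) ∧ 0 ≤ α ∧
      ∀ T : Matrix (Fin Xs.rank) (Fin Xs.rank) ℝ, T.transpose = T →
        ‖T‖ ≤ α * ‖restrictMap P.Amap Vs T‖ := by
    rcases sigmaMin_eq_top_or_pos (restrictMap P.Amap Vs)
      (h.eq_zero_of_restrictMap_eq_zero huniq hVV hV) with ⟨h1, h2⟩ | ⟨-, s, hs, h1, h2⟩
    · refine ⟨0, Or.inl ⟨h1, rfl⟩, fun _ => h2, le_rfl, fun T _ => ?_⟩
      have : IsEmpty (Fin Xs.rank) := by rw [h2]; infer_instance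
      rw [Subsingleton.elim T 0]
      simp
    · refine ⟨s⁻¹, Or.inr ⟨s, hs, h1, rfl⟩, fun h0 => absurd h0 (inv_pos.2 hs).ne',
        (inv_pos.2 hs).le, fun T hT => ?_⟩
      rw [← div_eq_inv_mul, le_div_iff₀ hs, mul_comm]
      exact h2 T hT
  have hrank : n - Xs.rank = (P.Z ys).rank := by
    have := h.2.2.2
    omega
  obtain ⟨β, hβ, hl⟩ : ∃ β : ℝ, ((kthEigenvalue (P.Z_isHermitian ys) (n - Xs.rank) = ⊤ ∧ β = 0) ∨
      ∃ x : ℝ, 0 < x ∧ kthEigenvalue (P.Z_isHermitian ys) (n - Xs.rank) = (x : EReal) ∧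
        β = x⁻¹) ∧ (β = 0 → (P.Z ys).rank = 0) ∧ 0 ≤ β ∧
      ∀ i, hZ.1.eigenvalues i ≠ 0 → 1 ≤ β * hZ.1.eigenvalues i := by
    rw [hrank]
    by_cases h0 : (P.Z ys).rank = 0
    · exact ⟨0, Or.inl ⟨by rw [kthEigenvalue, if_pos h0], rfl⟩, fun _ => h0, le_rfl,
        fun i hi => absurd (hZ.eigenvalues_eq_zero_of_rank_eq_zero h0 i) hi⟩
    · obtain ⟨l, hl, h1, h2⟩ := hZ.kthEigenvalue_rank h0
      refine ⟨l⁻¹, Or.inr ⟨l, hl, h1, rfl⟩, fun h3 => absurd h3 (inv_pos.2 hl).ne',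
        (inv_pos.2 hl).le, fun i hi => ?_⟩
      rw [← div_eq_inv_mul, le_div_iff₀ hl, one_mul]
      exact h2 i hi
  refine ⟨Q, GZ, Vs * S⁻¹ * Vs.transpose, α, β, hQ, hGZ, by rw [hGZ, hZQ], hQX, hXG, hXGX, hσ.2.1,
    hl.2.1, fun D hDt hQD => ?_, hgap β hl.2.2, fun ρ B hρ hB => ?_⟩
  · have hPD : Vs * Vs.transpose * D = D := by
      rw [← hQP, Matrix.sub_mul, hQD]
      simp
    have hDP : D * (Vs * Vs.transpose) = D := by
      rw [← Matrix.transpose_inj, Matrix.transpose_mul, hDt, Matrix.transpose_mul,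
        Matrix.transpose_transpose, hPD]
    have hfac : D = Vs * (Vs.transpose * D * Vs) * Vs.transpose := by
      conv_lhs => rw [← hDP, ← hPD]
      simp only [Matrix.mul_assoc]
    have h1 := hσ.2.2 (Vs.transpose * D * Vs) (by
      simp only [Matrix.transpose_mul, Matrix.transpose_transpose, hDt, Matrix.mul_assoc])
    rw [← norm_conj_of_orthonormal hVV, ← hfac] at h1
    have h2 : restrictMap P.Amap Vs (Vs.transpose * D * Vs) = P.Amap D := congrArg P.Amap hfac.symm
    rwa [h2] at h1
  · refine exists_growth_constant hB hρ hβ hα ?_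
    by_contra! hcon
    have := hσ.1 hcon.1
    have := hl.1 hcon.2
    have := h.2.2.2
    omega

/-- Solutions of the subproblem converge to the primal solution as `y → ys`, uniformly in
`ρ ≥ ρ₀`. The KKT conditions make both `⟨Z(ys), X⟩` and `‖𝓐 X - b‖` of order `‖y - ys‖`, dual
Slater bounds `X`, and quadratic growth at the nominal pair converts this into a distance. -/
theorem StrictComplementaryPair.exists_radius {Q : Matrix (Fin n) (Fin n) ℝ} {α β M ρ₀ : ℝ}
    (h : P.StrictComplementaryPair Xs ys) (hslater : P.DualSlater) (hρ₀ : 0 < ρ₀)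
    (hQ : IsOrthProj Q) (hQX : Q * Xs = 0) (hα : 0 ≤ α) (hβ : 0 ≤ β)
    (hD : ∀ D : Matrix (Fin n) (Fin n) ℝ, D.transpose = D → Q * D = 0 → ‖D‖ ≤ α * ‖P.Amap D‖)
    (hM : ∀ E : Matrix (Fin n) (Fin n) ℝ, E.transpose = E → ‖P.Amap E‖ ≤ M * ‖E‖)
    (hgap : (β • P.Z ys - Q).PosSemidef) {ε : ℝ} (hε : 0 < ε) :
    ∃ c : ℝ, 0 < c ∧ ∀ (ρ : ℝ) (y : EuclideanSpace ℝ (Fin m)), ρ₀ ≤ ρ → ‖y - ys‖ ≤ c →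
      ∀ X z, P.ALKKT ρ y X z → ‖X - Xs‖ ≤ ε := by
  obtain ⟨y₀, hy₀⟩ := hslater
  obtain ⟨β₀, hβ₀, htr⟩ := trace_le_mul_of_posDef hy₀
  obtain ⟨B, hB⟩ : ∃ B, B = β₀ * ((1 + ‖ys - y₀‖) * (‖P.b‖ + 2 / ρ₀)) := ⟨_, rfl⟩
  have hB0 : 0 ≤ B := by rw [hB]; positivity
  obtain ⟨w, hw⟩ : ∃ w, w = (1 + 2 * M ^ 2 * α ^ 2) * (2 * B * β) := ⟨_, rfl⟩
  have hw0 : 0 ≤ w := by rw [hw]; positivity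
  obtain ⟨γ, hγ⟩ : ∃ γ, γ = min (w + 1)⁻¹ (ρ₀ / (4 * α ^ 2 + 1)) := ⟨_, rfl⟩
  have hγ0 : 0 < γ := by rw [hγ]; positivity
  have hγ1 : γ * w ≤ 1 := by
    calc γ * w ≤ (w + 1)⁻¹ * (w + 1) := by
          gcongr
          · rw [hγ]
            exact min_le_left _ _
          · linarith
      _ = 1 := inv_mul_cancel₀ (by positivity)
  have hγ2 : 4 * α ^ 2 * γ ≤ ρ₀ := by
    calc 4 * α ^ 2 * γ ≤ (4 * α ^ 2 + 1) * (ρ₀ / (4 * α ^ 2 + 1)) := by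
          gcongr
          · linarith
          · rw [hγ]
            exact min_le_right _ _
      _ = ρ₀ := mul_div_cancel₀ _ (by positivity)
  refine ⟨min 1 (γ * ε ^ 2 / (‖P.b‖ + 4 / ρ₀)), by positivity, fun ρ y hρ hy X z hk => ?_⟩
  set c := ‖y - ys‖ with hc
  have hρ' : 0 < ρ := hρ₀.trans_le hρ
  have hc0 : 0 ≤ c := norm_nonneg _
  have hc1 : c ≤ 1 := hy.trans (min_le_left _ _)
  have hc2 : c * (‖P.b‖ + 4 / ρ₀) ≤ γ * ε ^ 2 :=
    (le_div_iff₀ (by positivity)).1 (hy.trans (min_le_right _ _))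
  have hz : ‖z - ys‖ ≤ c := hk.norm_sub_le hρ' h.1.1 h.2.1.1 h.frobInner_eq_zero
  have hres : ‖P.Amap X - P.b‖ ≤ 2 * c / ρ₀ := by
    rw [hk.1, add_sub_cancel_right, norm_smul, Real.norm_of_nonneg (by positivity)]
    have h1 : ‖y - z‖ ≤ 2 * c := by
      have : y - z = (y - ys) - (z - ys) := by abel
      rw [this]
      linarith [norm_sub_le (y - ys) (z - ys)]
    calc 1 / ρ * ‖y - z‖ ≤ 1 / ρ₀ * (2 * c) := by gcongr
      _ = 2 * c / ρ₀ := by ring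
  have hAX : ‖P.Amap X‖ ≤ ‖P.b‖ + 2 / ρ₀ := by
    have h1 := norm_add_le (P.Amap X - P.b) P.b
    rw [sub_add_cancel] at h1
    have h2 : 2 * c / ρ₀ ≤ 2 / ρ₀ := by
      gcongr
      linarith
    linarith
  -- Complementarity turns every `⟨Z w, X⟩` into a pairing of `z - w` with `𝓐 X`.
  have hpair : ∀ w, frobInner (P.Z w) X ≤ ‖z - w‖ * (‖P.b‖ + 2 / ρ₀) := by
    intro w
    have h0 := hk.frobInner_eq_zero
    rw [frobInner_Z] at h0
    have h1 := real_inner_le_norm (z - w) (P.Amap X)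
    rw [inner_sub_left] at h1
    rw [frobInner_Z]
    have h2 := mul_le_mul_of_nonneg_left hAX (norm_nonneg (z - w))
    linarith
  have htrX : X.trace ≤ B := by
    refine (htr X hk.2.2.1).trans ?_
    rw [hB]
    refine mul_le_mul_of_nonneg_left ((hpair y₀).trans ?_) hβ₀
    gcongr
    have : z - y₀ = (z - ys) + (ys - y₀) := by abel
    rw [this]
    linarith [norm_add_le (z - ys) (ys - y₀)]
  have hgapX : frobInner Q X ≤ β * frobInner (P.Z ys) X := by
    have h1 := hgap.frobInner_nonneg hk.2.2.1
    rw [frobInner_sub_left, frobInner_smul_left] at h1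
    linarith
  have hgrow := quadratic_growth hQ hα hβ hγ0.le hD hM hk.2.2.1 htrX
    (Matrix.PosSemidef.frobInner_nonneg h.2.1.1 hk.2.2.1) hgapX h.1.1.2.transpose_eq hQX
    (by rw [← hw]; exact hγ1) hγ2
  rw [h.1.1.1] at hgrow
  have h1 : frobInner (P.Z ys) X ≤ c * (‖P.b‖ + 2 / ρ₀) :=
    (hpair ys).trans (mul_le_mul_of_nonneg_right hz (by positivity))
  have h2 : ρ₀ / 2 * ‖P.Amap X - P.b‖ ^ 2 ≤ c * (2 / ρ₀) := by
    calc ρ₀ / 2 * ‖P.Amap X - P.b‖ ^ 2 ≤ ρ₀ / 2 * (2 * c / ρ₀) ^ 2 := by gcongr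
      _ = c * (2 / ρ₀) * c := by field_simp
      _ ≤ c * (2 / ρ₀) * 1 := by gcongr
      _ = c * (2 / ρ₀) := mul_one _
  have h3 : γ * ‖X - Xs‖ ^ 2 ≤ γ * ε ^ 2 := by
    refine hgrow.trans ((add_le_add h1 h2).trans (le_trans (le_of_eq ?_) hc2))
    ring
  exact le_of_sq_le_sq (le_of_mul_le_mul_left h3 hγ0) hε.le

end SDP

/-! ### Stability and growth for the subproblem -/

theorem mainTheorem1 {n m : ℕ} (hn : 0 < n) (P : SDP n m)
    (hsimple : P.PrimalSimple) (hslater : P.DualSlater)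
    (Xs : Matrix (Fin n) (Fin n) ℝ) (ys : EuclideanSpace ℝ (Fin m))
    (hpair : P.StrictComplementaryPair Xs ys)
    (Vs : Matrix (Fin n) (Fin Xs.rank) ℝ)
    (hVs_orth : Vs.transpose * Vs = 1)
    (hVs_range : LinearMap.range Vs.mulVecLin = LinearMap.ker (P.Z ys).mulVecLin)
    (ρ₀ : ℝ) (hρ₀ : 0 < ρ₀) :
    ∃ c : ℝ, 0 < c ∧ ∀ ρ : ℝ, ρ₀ ≤ ρ →
      (∀ y : EuclideanSpace ℝ (Fin m), ‖y - ys‖ ≤ c →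
        P.ALPrimalSimple ρ y ∧
        ∀ X z, P.ALPrimalOptimal ρ y X → P.ALDualOptimal ρ y z →
          X.rank = Xs.rank ∧ (P.Z z).rank = (P.Z ys).rank) ∧
      (∀ B : ℝ, 0 < B → ∃ γ : ℝ, 0 < γ ∧ P.growthBound ys Vs ρ B ≤ (γ : EReal) ∧
        ∀ y : EuclideanSpace ℝ (Fin m), ‖y - ys‖ ≤ c →
          ∀ Xy zy, P.ALPrimalOptimal ρ y Xy → P.ALDualOptimal ρ y zy →
            ∀ X : Matrix (Fin n) (Fin n) ℝ, X.PosSemidef → nucNorm X ≤ B →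
              P.augLagrangian ρ X y - P.augLagrangian ρ Xy y =
                frobInner (P.Z zy) X + ρ / 2 * ‖P.Amap X - P.Amap Xy‖ ^ 2 ∧
              γ * frobNorm (X - Xy) ^ 2 ≤
                frobInner (P.Z zy) X + ρ / 2 * ‖P.Amap X - P.Amap Xy‖ ^ 2) := by
  obtain ⟨Q, GZ, GX, α, β, hQ, hGZ, hZGZ, hQX, hXG, hXGX, hα, hβ, hD, hgap, hgrowth⟩ :=
    hpair.exists_growth_data hn hsimple.2.2 hVs_orth hVs_range
  have hM := fun E hE => norm_le_sigmaMax_mul P.Amap (S := E) hE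
  have hM0 := sigmaMax_nonneg P.Amap
  obtain ⟨M, hMdef⟩ : ∃ M, M = sigmaMax P.Amap := ⟨_, rfl⟩
  rw [← hMdef] at hM hM0 hgrowth
  obtain ⟨c₀, hc₀, hclose⟩ := hpair.exists_radius hslater hρ₀ hQ hQX hα hβ hD hM hgap
    (ε := (4 * ‖GX‖ + 1)⁻¹) (by positivity)
  obtain ⟨w, hw⟩ : ∃ w, w = 8 * ‖GZ‖ * (1 + α * M) + 10 * β + 1 := ⟨_, rfl⟩
  have hw1 : 8 * ‖GZ‖ * (1 + α * M) ≤ w := by rw [hw]; linarith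
  have hw2 : 10 * β ≤ w := by
    have : 0 ≤ 8 * ‖GZ‖ * (1 + α * M) := by positivity
    rw [hw]; linarith
  have hw0 : 0 < w := by rw [hw]; positivity
  obtain ⟨K, hK⟩ : ∃ K, K = ∑ i, ‖P.A i‖ := ⟨_, rfl⟩
  have hK0 : 0 ≤ K := by rw [hK]; positivity
  refine ⟨min c₀ (w⁻¹ / (K + 1)), by positivity, fun ρ hρ => ?_⟩
  have hρ' : 0 < ρ := hρ₀.trans_le hρ
  -- Near the nominal pair, all the smallness conditions of the perturbation lemmas hold.
  have hnear : ∀ y : EuclideanSpace ℝ (Fin m), ‖y - ys‖ ≤ min c₀ (w⁻¹ / (K + 1)) →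
      ∀ X z, P.ALKKT ρ y X z →
        w * ‖P.Z ys - P.Z z‖ ≤ 1 ∧ 4 * ‖GX‖ * ‖Xs - X‖ ≤ 1 ∧ ‖Xs - X‖ * ‖GX‖ < 1 := by
    intro y hy X z hk
    have h1 : ‖z - ys‖ * (K + 1) ≤ w⁻¹ := (le_div_iff₀ (by positivity)).1
      ((hk.norm_sub_le hρ' hpair.1.1 hpair.2.1.1 hpair.frobInner_eq_zero).trans
        (hy.trans (min_le_right _ _)))
    have h2 : ‖P.Z ys - P.Z z‖ ≤ w⁻¹ := by
      have := P.norm_Z_sub_le ys z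
      rw [← hK] at this
      nlinarith [norm_nonneg (z - ys)]
    have h3 : ‖Xs - X‖ ≤ (4 * ‖GX‖ + 1)⁻¹ := by
      rw [norm_sub_rev]
      exact hclose ρ y hρ (hy.trans (min_le_left _ _)) X z hk
    have h4 : (4 * ‖GX‖ + 1) * ‖Xs - X‖ ≤ 1 := by
      have := mul_le_mul_of_nonneg_left h3 (show 0 ≤ 4 * ‖GX‖ + 1 by positivity)
      rwa [mul_inv_cancel₀ (by positivity)] at this
    refine ⟨?_, ?_, ?_⟩
    · have := mul_le_mul_of_nonneg_left h2 hw0.le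
      rwa [mul_inv_cancel₀ hw0.ne'] at this
    · linarith [norm_nonneg (Xs - X)]
    · linarith [norm_nonneg (Xs - X)]
  have hrank : ∀ y : EuclideanSpace ℝ (Fin m), ‖y - ys‖ ≤ min c₀ (w⁻¹ / (K + 1)) →
      ∀ X z, P.ALKKT ρ y X z → X.rank = Xs.rank ∧ (P.Z z).rank = (P.Z ys).rank := by
    intro y hy X z hk
    obtain ⟨h1, -, h2⟩ := hnear y hy X z hk
    have h3 := rank_le_of_norm_sub_mul_lt hXGX h2
    have h4 : ‖P.Z ys - P.Z z‖ * ‖GZ‖ < 1 := by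
      have h5 : 0 ≤ 8 * ‖GZ‖ * (α * M) := by positivity
      have h6 : 8 * ‖GZ‖ * ‖P.Z ys - P.Z z‖ ≤ w * ‖P.Z ys - P.Z z‖ :=
        mul_le_mul_of_nonneg_right (by linarith) (norm_nonneg _)
      linarith [mul_nonneg (norm_nonneg GZ) (norm_nonneg (P.Z ys - P.Z z))]
    have h5 := rank_le_of_norm_sub_mul_lt hZGZ h4
    have h6 := Matrix.rank_add_rank_le_card_of_mul_eq_zero hk.2.1
    rw [Fintype.card_fin] at h6
    have h7 := hpair.2.2.2
    omega
  have hquad : ∀ B : ℝ, 0 < B → ∃ γ : ℝ, 0 < γ ∧ P.growthBound ys Vs ρ B ≤ (γ : EReal) ∧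
      ∀ y : EuclideanSpace ℝ (Fin m), ‖y - ys‖ ≤ min c₀ (w⁻¹ / (K + 1)) →
        ∀ Xy zy, P.ALKKT ρ y Xy zy → ∀ X : Matrix (Fin n) (Fin n) ℝ, X.PosSemidef →
          X.trace ≤ B → γ * ‖X - Xy‖ ^ 2 ≤
            frobInner (P.Z zy) X + ρ / 2 * ‖P.Amap X - P.Amap Xy‖ ^ 2 := by
    intro B hB
    obtain ⟨γ, hγ, hbound, hγ1, hγ2⟩ := hgrowth ρ B hρ' hB
    refine ⟨γ, hγ, hbound, fun y hy Xy zy hk X hX htr => ?_⟩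
    obtain ⟨h1, h2, -⟩ := hnear y hy Xy zy hk
    have hZz : (P.Z zy).PosSemidef := hk.2.2.2
    obtain ⟨Q', G', hQ', hZQ', hG', -⟩ := hZz.1.exists_range_projection
    have hQX' : Q' * Xy = 0 := by rw [← hG', Matrix.mul_assoc, hk.2.1, Matrix.mul_zero]
    refine quadratic_growth (α := 4 / 3 * α) (β := 5 / 4 * β) (M := M) hQ' (by positivity)
      (by positivity) hγ.le (fun D hDt hQD => ?_) hM hX htr (hZz.frobInner_nonneg hX) ?_
      hk.2.2.1.transpose_eq hQX' ?_ ?_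
    · refine norm_le_of_perturb hQ hα hM0 hGZ hD hM (Z' := P.Z zy)
        ((mul_le_mul_of_nonneg_right hw1 (norm_nonneg _)).trans h1) hDt ?_
      rw [← hZQ', Matrix.mul_assoc, hQD, Matrix.mul_zero]
    · exact frobInner_proj_le_of_perturb hQ hβ hgap hXG (P.Z_transpose zy) hQ' hZQ' hQX'
        ((mul_le_mul_of_nonneg_right hw2 (norm_nonneg _)).trans h1) h2 hX
    -- The factors `5/4` and `16/9` lost by perturbation are absorbed by the constants `4` and `10`.
    · have h3 : 0 ≤ γ * (B * β) := by positivity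
      have h4 : 0 ≤ γ * (B * β) * (M ^ 2 * α ^ 2) := by positivity
      nlinarith
    · have h3 : 0 ≤ α ^ 2 * γ := by positivity
      nlinarith
  refine ⟨fun y hy => ?_, fun B hB => ?_⟩
  · obtain ⟨X₁, hX₁⟩ := P.exists_alPrimalOptimal hslater hρ' y
    have hk := hX₁.alKKT hρ'
    have hz := hk.alDualOptimal hρ'
    refine ⟨⟨⟨⟨X₁, _, hX₁, hz⟩, fun X z hX hz => hX.alKKT_of_alDualOptimal hρ' hz⟩,
      ⟨X₁, _, hX₁, hz, hk, ?_⟩, X₁, hX₁, fun X₂ hX₂ => ?_⟩, fun X z hX hz =>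
        hrank y hy X z (hX.alKKT_of_alDualOptimal hρ' hz)⟩
    · obtain ⟨h1, h2⟩ := hrank y hy _ _ hk
      rw [h1, h2]
      exact hpair.2.2.2
    -- Quadratic growth forces a second minimizer to coincide with the first.
    · obtain ⟨γ, hγ, -, hg⟩ := hquad (X₂.trace + 1) (by linarith [hX₂.1.trace_nonneg])
      have h1 := hg y hy X₁ _ hk X₂ hX₂.1 (by linarith)
      rw [← hk.augLagrangian_sub hρ'] at h1
      have h2 := hX₂.2 X₁ hX₁.1
      have h3 : ‖X₂ - X₁‖ ^ 2 ≤ 0 := nonpos_of_mul_nonpos_right (by linarith) hγ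
      have h4 : ‖X₂ - X₁‖ = 0 := by nlinarith [norm_nonneg (X₂ - X₁)]
      exact sub_eq_zero.1 (norm_eq_zero.1 h4)
  · obtain ⟨γ, hγ, hbound, hg⟩ := hquad B hB
    refine ⟨γ, hγ, hbound, fun y hy Xy zy hXy hzy X hX hnuc => ?_⟩
    have hk := hXy.alKKT_of_alDualOptimal hρ' hzy
    rw [hX.nucNorm_eq_trace] at hnuc
    exact ⟨hk.augLagrangian_sub hρ' X, hg y hy Xy zy hk X hX hnuc⟩

end
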